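/- **Setting.** Let $\mathcal A$ be a finite alphabet with at least two symbols and $\Omega=\mathcal A^{\mathbb Z}$, with translations $(\tau_i\sigma)(j)=\sigma(i+j)$; let $C_n=\{1,\dots,n\}$. Let $U(V,\sigma)$, for $V\subset\mathbb Z$ finite and $\sigma\in\Omega$, be a real translation-invariant interaction with exponential decay, that is, $U(V,\cdot)$ is measurable with respect to $(\sigma(i))_{i\in V}$, $U(V+i,\tau_{-i}\sigma)=U(V,\sigma)$ for all $i\in\mathbb Z$, and $\sum_{V\ni 0}e^{\gamma\,\mathrm{diam}(V)}\sup_{\sigma}|U(V,\sigma)|<\infty$ for some $\gamma>0$. Let $\mathbb P$ be the Gibbs measure on $\Omega$ with interaction $U$: for every finite $\Lambda\subset\mathbb Z$ and $\mathbb P$-almost every $\zeta$, the conditional distribution of $\sigma_\Lambda$ given $\sigma_{\Lambda^c}=\zeta_{\Lambda^c}$ gives $\sigma_\Lambda$ a probability proportional to $\exp\bigl(-\sum_{V\cap\Lambda\ne\emptyset}U(V,\sigma_\Lambda\zeta_{\Lambda^c})\bigr)$. Let $$p(U)=\lim_{n\to\infty}\frac1n\log\sum_{\sigma_{C_n}\in\mathcal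 A^{C_n}}\exp\Bigl(-\sum_{V\subseteq C_n}U(V,\sigma)\Bigr)$$ be the pressure, $\alpha=p(U)-\tfrac12p(2U)$, and $k^*(n)=(\log n)/\alpha$. For $n,k\in\mathbb N$ let $N(\sigma,n,k)$ be the number of pairs $0\le i<j\le n-k$ such that $\tau_i\sigma$ and $\tau_j\sigma$ coincide on $C_k$ (so $N=0$ if $k>n$). **Theorem 4.1.** Let $(k(n))_{n\in\mathbb N}$ be a sequence of nonnegative integers. 1. If $k^*(n)-k(n)\to\infty$, then $\lim_{n\to\infty}\mathbb P(N(\sigma,n,k(n))\le m)=0$ for every positive integer $m$. 2. If $k(n)-k^*(n)\to\infty$, then $\lim_{n\to\infty}\mathbb P(N(\sigma,n,k(n))\ge m)=0$ for every positive integer $m$. 3. If $k(n)-k^*(n)$ is bounded, then the sequence $N(\sigma,n,k(n))$, $n\in\mathbb N$, is tight and does not converge to $0$ in distribution. More precisely, there is a constant $C>0$ such that for every positive integer $m$ $$\limsup_{n\to\infty}\mathbb P(N(\sigma,n,k(n))>m)\le \frac Cm,\qquad\text{and}\qquad \liminf_{n\to\infty}\mathbb P(N(\sigma,n,k(n))>0)>0.$$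 -/

import Mathlib

open MeasureTheory ProbabilityTheory Filter Topology

namespace ShiftMatch

noncomputable section

/-- The translation `τ_i σ` of a configuration, `(τ_i σ)(j) = σ(i + j)`. -/
def shiftConfig {𝒜 : Type*} (i : ℤ) (σ : ℤ → 𝒜) : ℤ → 𝒜 := fun j => σ (i + j)

/-- The window `C_n = [1, n] ∩ ℤ` on which patterns of size `n` live. -/
def window (n : ℕ) : Finset ℤ := Finset.Icc 1 (n : ℤ)

/-- The number `N(σ, n, k)` of self shift-matches of length `k` up to `n`: the number of unordered
pairs of distinct positions `i, j ∈ {0, …, n - k}` (listed with `i < j`, so that it is one half of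
the number of ordered pairs) such that `τ_i σ` and `τ_j σ` agree on `C_k`.
It is `0` if `k > n` (the set of positions is then empty). -/
def matchCount {𝒜 : Type*} [DecidableEq 𝒜] (σ : ℤ → 𝒜) (n k : ℕ) : ℕ :=
  ((Finset.range (n + 1 - k) ×ˢ Finset.range (n + 1 - k)).filter fun p : ℕ × ℕ =>
    p.1 < p.2 ∧ ∀ l ∈ window k, shiftConfig (p.1 : ℤ) σ l = shiftConfig (p.2 : ℤ) σ l).card

/-- `U : 𝒮 × Ω → ℝ` is a translation-invariant interaction with exponential decay.
`Metric.diam` of a finite nonempty set of integers is its diameter `max |i - j|`. -/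
structure IsInteraction {𝒜 : Type*} [MeasurableSpace 𝒜] (U : Finset ℤ → (ℤ → 𝒜) → ℝ) :
    Prop where
  /-- `U(V, ·)` is measurable with respect to the coordinates in `V`. -/
  measurable : ∀ V : Finset ℤ, Measurable[cylinderEvents (V : Set ℤ)] (U V)
  /-- `U(V + i, τ_{-i} σ) = U(V, σ)`. -/
  translation_invariant : ∀ (V : Finset ℤ) (i : ℤ) (σ : ℤ → 𝒜),
    U (V.image fun j => j + i) (shiftConfig (-i) σ) = U V σ
  /-- `∑_{V ∋ 0} exp(γ diam V) sup_σ |U(V, σ)| < ∞` for some `γ > 0`. -/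
  exponential_decay : ∃ γ : ℝ, 0 < γ ∧ Summable fun V : {V : Finset ℤ // (0 : ℤ) ∈ V} =>
    Real.exp (γ * Metric.diam ((V : Finset ℤ) : Set ℤ)) * ⨆ σ : ℤ → 𝒜, |U V σ|

/-- The finite-volume energy `∑_{V ∩ Λ ≠ ∅} U(V, ξ)`. With `ξ = σ_Λ ζ_{Λᶜ}` this is the Hamiltonian
in `Λ` with boundary condition `ζ`. The sum converges absolutely for an interaction. -/
def hamiltonian {𝒜 : Type*} (U : Finset ℤ → (ℤ → 𝒜) → ℝ) (Λ : Finset ℤ) (ξ : ℤ → 𝒜) : ℝ :=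
  ∑' V : {V : Finset ℤ // (V ∩ Λ).Nonempty}, U V ξ

/-- The partition function `Z_Λ^ζ` with boundary condition `ζ`. Here `Function.updateFinset ζ Λ ω`
is the configuration equal to `ω` on `Λ` and to `ζ` off `Λ`. -/
def partitionFunction {𝒜 : Type*} [Fintype 𝒜] (U : Finset ℤ → (ℤ → 𝒜) → ℝ) (Λ : Finset ℤ)
    (ζ : ℤ → 𝒜) : ℝ :=
  ∑ ω : Λ → 𝒜, Real.exp (-hamiltonian U Λ (Function.updateFinset ζ Λ ω))

/-- The probability of `ω ∈ Ω_Λ` under the finite-volume Gibbs measure in `Λ` with boundary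
condition `ζ`. -/
def gibbsWeight {𝒜 : Type*} [Fintype 𝒜] (U : Finset ℤ → (ℤ → 𝒜) → ℝ) (Λ : Finset ℤ)
    (ζ : ℤ → 𝒜) (ω : Λ → 𝒜) : ℝ :=
  Real.exp (-hamiltonian U Λ (Function.updateFinset ζ Λ ω)) / partitionFunction U Λ ζ

/-- `μ` is a Gibbs measure with interaction `U`: for every finite `Λ`, the conditional distribution
of `σ_Λ` given the configuration `ζ` off `Λ` is the finite-volume Gibbs measure, `μ`-almost
surely. -/
def IsGibbsMeasure {𝒜 : Type*} [Fintype 𝒜] [MeasurableSpace 𝒜] (U : Finset ℤ → (ℤ → 𝒜) → ℝ)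
    (μ : Measure (ℤ → 𝒜)) : Prop :=
  ∀ (Λ : Finset ℤ) (ω : Λ → 𝒜),
    μ⟦{σ : ℤ → 𝒜 | Λ.restrict σ = ω} | cylinderEvents ((Λ : Set ℤ)ᶜ)⟧
      =ᵐ[μ] fun ζ => gibbsWeight U Λ ζ ω

/-- The partition function `Z_n` on `C_n` with free boundary conditions. For an interaction,
the terms `U(V, ·)` with `V ⊆ C_n` depend only on the configuration inside `C_n`, so the
configuration used to extend `ω` outside `C_n` plays no role. -/
def freePartitionFunction {𝒜 : Type*} [Fintype 𝒜] [Nonempty 𝒜] (U : Finset ℤ → (ℤ → 𝒜) → ℝ)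
    (n : ℕ) : ℝ :=
  ∑ ω : window n → 𝒜, Real.exp (-∑ V ∈ (window n).powerset,
    U V (Function.updateFinset (fun _ => Classical.arbitrary 𝒜) (window n) ω))

/-- The pressure `p(U) = lim (1/n) log Z_n`; the limit exists for every interaction. -/
def pressure {𝒜 : Type*} [Fintype 𝒜] [Nonempty 𝒜] (U : Finset ℤ → (ℤ → 𝒜) → ℝ) : ℝ :=
  limUnder atTop fun n : ℕ => (1 / (n : ℝ)) * Real.log (freePartitionFunction U n)

/-- `α = p(U) - p(2U)/2`. -/
def alpha {𝒜 : Type*} [Fintype 𝒜] [Nonempty 𝒜] (U : Finset ℤ → (ℤ → 𝒜) → ℝ) : ℝ :=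
  pressure U - pressure ((2 : ℝ) • U) / 2

/-- The scale `k*(n) = (log n) / α`. -/
def kStar {𝒜 : Type*} [Fintype 𝒜] [Nonempty 𝒜] (U : Finset ℤ → (ℤ → 𝒜) → ℝ) (n : ℕ) : ℝ :=
  Real.log n / alpha U

end

end ShiftMatch

/-! Exponential decay bounds the total interaction across any cut of the line. Hence the conditional
law of the word on a block of length `k`, given everything off the block, agrees with the free Gibbs
weight `wordWeight` up to a factor independent of `k`, of the place and of the outside
(`exists_measure_blockWord_bounds`). Two disjoint blocks therefore spell the same word with
probability of order `∑ w, wordWeight U k w ^ 2 = Z_k(2U) / Z_k(U)^2`. Since `log Z_k` is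
quasi-additive, this is `exp (-2αk)` up to constants, without subexponential corrections, which is
what permits statements on a bounded window around `k*`. With about `n^2` pairs, the expected number
of matches is governed by `x = n exp (-αk)`, which is of order one at `k = k*(n)`.

The obstacle is the dependence caused by overlapping blocks. A match of overlapping blocks, or a
second match overlapping a first one, forces letters to be copies of letters elsewhere, and this
costs at most the maximal weight of a word. Altering letters one at a time shows that the maximal
weight decays like `exp (-(α+c)k)` with `c > 0`, strictly faster than the square root of the
two-replica sum (`exists_wordWeight_bounds`). This margin makes correlations summable in the
displacement of the blocks. `MatchEstimates` records all that is needed of the measure.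

Markov's inequality with mean `O(x (T + x))` gives the upper bounds. For the lower bounds, the
second moment method, run conditionally on the outside, shows that a block of length of order `exp
(αk)` contains a match with probability at least `δ` (`exists_le_matchWithin`). Below the critical
scale `C_n` splits into arbitrarily many such blocks, and the conditional bound can be iterated as
for independent trials; at the critical scale one block is enough. -/

namespace ShiftMatch

/-! ### Summability of the interaction across a cut -/

section Interaction

variable {𝒜 : Type*} {U : Finset ℤ → (ℤ → 𝒜) → ℝ}

/-- The supremum norm of the potential `U(V, ·)`. -/
noncomputable def supNorm (U : Finset ℤ → (ℤ → 𝒜) → ℝ) (V : Finset ℤ) : ℝ :=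
  ⨆ σ : ℤ → 𝒜, |U V σ|

lemma supNorm_nonneg (V : Finset ℤ) : 0 ≤ supNorm U V :=
  Real.iSup_nonneg fun _ => abs_nonneg _

/-- The finite sets of sites with elements on both sides of the cut between `x` and `x + 1`. -/
def Crosses (x : ℤ) (V : Finset ℤ) : Prop := (∃ a ∈ V, a ≤ x) ∧ ∃ b ∈ V, x < b

variable [MeasurableSpace 𝒜]

/-- A real function measurable for the coordinates in `V` factors through the restriction to `V`;
this turns the measurability axiom into a pointwise one. -/
lemma IsInteraction.congr (hU : IsInteraction U) {V : Finset ℤ} {σ σ' : ℤ → 𝒜}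
    (h : ∀ i ∈ V, σ i = σ' i) : U V σ = U V σ' := by
  have hle : cylinderEvents (X := fun _ : ℤ => 𝒜) (V : Set ℤ) ≤
      Filtration.piFinset (X := fun _ : ℤ => 𝒜) V := by
    refine iSup₂_le fun i hi => ?_
    have : (fun σ : ℤ → 𝒜 => σ i) = (fun x : V → 𝒜 => x ⟨i, hi⟩) ∘ V.restrict := rfl
    rw [this, ← MeasurableSpace.comap_comp]
    exact MeasurableSpace.comap_mono (measurable_pi_apply _).comap_le
  exact (Measurable.dependsOn_of_piFinset ((hU.measurable V).mono hle le_rfl)) h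

lemma IsInteraction.apply_shiftConfig (hU : IsInteraction U) (V : Finset ℤ) (s : ℤ)
    (ξ : ℤ → 𝒜) : U V (shiftConfig s ξ) = U (V.image fun j => j + s) ξ := by
  rw [← hU.translation_invariant V s (shiftConfig s ξ)]
  congr 1
  ext j
  simp [shiftConfig]

lemma IsInteraction.supNorm_image (hU : IsInteraction U) (V : Finset ℤ) (t : ℤ) :
    supNorm U (V.image fun j => j + t) = supNorm U V := by
  symm
  refine Function.Surjective.iSup_congr (fun σ => shiftConfig (-t) σ) (fun σ => ?_) fun σ => ?_
  · exact ⟨shiftConfig t σ, by ext j; simp [shiftConfig]⟩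
  · rw [hU.translation_invariant]

/-- Translation moves `x` to the origin, and the weight `exp (γ diam V)` in the decay condition then
pays for the factor `exp (-γr)`. -/
lemma IsInteraction.exists_sum_supNorm_le (hU : IsInteraction U) :
    ∃ γ > 0, ∃ A ≥ 0, ∀ (x : ℤ) (r : ℝ) (F : Finset (Finset ℤ)),
      (∀ V ∈ F, x ∈ V ∧ r ≤ Metric.diam (V : Set ℤ)) →
        ∑ V ∈ F, supNorm U V ≤ Real.exp (-(γ * r)) * A := by
  obtain ⟨γ, hγ, hs⟩ := hU.exponential_decay
  set g : {V : Finset ℤ // (0 : ℤ) ∈ V} → ℝ := fun V =>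
    Real.exp (γ * Metric.diam ((V : Finset ℤ) : Set ℤ)) * supNorm U V with hg
  have hs : Summable g := hs
  have hg0 : ∀ V, 0 ≤ g V := fun V => mul_nonneg (Real.exp_pos _).le (supNorm_nonneg _)
  refine ⟨γ, hγ, ∑' V, g V, tsum_nonneg hg0, fun x r F hF => ?_⟩
  let φ : {V // V ∈ F} → {V : Finset ℤ // (0 : ℤ) ∈ V} := fun V =>
    ⟨V.1.image fun j => j + (-x), Finset.mem_image.2 ⟨x, (hF V.1 V.2).1, by simp⟩⟩
  have hφ : Function.Injective φ := by
    intro V W h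
    have h' := congrArg Subtype.val h
    exact Subtype.ext (Finset.image_injective (add_left_injective (-x)) h')
  have hterm : ∀ V : {V // V ∈ F}, supNorm U V.1 ≤ Real.exp (-(γ * r)) * g (φ V) := by
    intro V
    have hd : Metric.diam (((V.1.image fun j => j + (-x)) : Finset ℤ) : Set ℤ)
        = Metric.diam (V.1 : Set ℤ) := by
      rw [Finset.coe_image]
      exact (IsometryEquiv.addRight (-x)).isometry.diam_image _
    simp only [hg, φ]
    rw [hU.supNorm_image, hd, ← mul_assoc, ← Real.exp_add]
    refine le_mul_of_one_le_left (supNorm_nonneg _) (Real.one_le_exp ?_)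
    nlinarith [(hF V.1 V.2).2]
  calc ∑ V ∈ F, supNorm U V = ∑ V ∈ F.attach, supNorm U V.1 := (Finset.sum_attach F _).symm
    _ ≤ ∑ V ∈ F.attach, Real.exp (-(γ * r)) * g (φ V) := Finset.sum_le_sum fun V _ => hterm V
    _ = Real.exp (-(γ * r)) * ∑ V ∈ F.attach.map ⟨φ, hφ⟩, g V := by
        rw [Finset.sum_map, Finset.mul_sum]; rfl
    _ ≤ _ := by
        gcongr
        exact hs.sum_le_tsum _ fun V _ => hg0 V

lemma IsInteraction.exists_sum_mem_le (hU : IsInteraction U) :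
    ∃ A ≥ 0, ∀ (x : ℤ) (F : Finset (Finset ℤ)), (∀ V ∈ F, x ∈ V) →
      ∑ V ∈ F, supNorm U V ≤ A := by
  obtain ⟨γ, -, A, hA, h⟩ := hU.exists_sum_supNorm_le
  refine ⟨A, hA, fun x F hF => ?_⟩
  simpa using h x 0 F fun V hV => ⟨hF V hV, Metric.diam_nonneg⟩

/-- A set crossing the cut contains some `x - j` with `j ≥ 0` and has diameter at least `j`. Sorting
by `j` leaves a geometric series. -/
lemma IsInteraction.exists_sum_crosses_le (hU : IsInteraction U) :
    ∃ D ≥ 0, ∀ (x : ℤ) (F : Finset (Finset ℤ)), (∀ V ∈ F, Crosses x V) →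
      ∑ V ∈ F, supNorm U V ≤ D := by
  obtain ⟨γ, hγ, A, hA, h⟩ := hU.exists_sum_supNorm_le
  have hsum : Summable fun j : ℕ => Real.exp (-(γ * j)) := by
    refine (Real.summable_exp_nat_mul_iff (a := -γ)).2 (by linarith) |>.congr fun j => ?_
    ring_nf
  refine ⟨(∑' j : ℕ, Real.exp (-(γ * j))) * A,
    mul_nonneg (tsum_nonneg fun _ => (Real.exp_pos _).le) hA, fun x F hF => ?_⟩
  classical
  have hex : ∀ V : Finset ℤ, ∃ j : ℕ, V ∈ F →
      x - j ∈ V ∧ (j : ℝ) ≤ Metric.diam (V : Set ℤ) := by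
    intro V
    by_cases hV : V ∈ F
    · obtain ⟨⟨a, ha, hax⟩, b, hb, hxb⟩ := hF V hV
      refine ⟨(x - a).toNat, fun _ => ?_⟩
      have hj : (((x - a).toNat : ℕ) : ℤ) = x - a := Int.toNat_of_nonneg (by lia)
      refine ⟨by rw [hj]; simpa using ha, ?_⟩
      refine le_trans ?_ (Metric.dist_le_diam_of_mem V.finite_toSet.isBounded hb ha)
      rw [Int.dist_eq]
      refine le_trans ?_ (le_abs_self _)
      have hj' : ((x - a).toNat : ℝ) = (x : ℝ) - a := by exact_mod_cast congrArg (Int.cast (R := ℝ)) hj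
      have hxb' : (x : ℝ) ≤ b := by exact_mod_cast hxb.le
      linarith
    · exact ⟨0, fun h => absurd h hV⟩
  choose t ht using hex
  calc ∑ V ∈ F, supNorm U V
      = ∑ j ∈ F.image t, ∑ V ∈ F with t V = j, supNorm U V :=
        (Finset.sum_fiberwise_of_maps_to (fun V hV => Finset.mem_image_of_mem t hV) _).symm
    _ ≤ ∑ j ∈ F.image t, Real.exp (-(γ * j)) * A := by
        refine Finset.sum_le_sum fun j _ => h (x - j) j _ fun V hV => ?_
        obtain ⟨hVF, rfl⟩ := Finset.mem_filter.1 hV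
        exact ht V hVF
    _ ≤ _ := by
        rw [← Finset.sum_mul]
        gcongr
        exact hsum.sum_le_tsum _ fun _ _ => (Real.exp_pos _).le

variable [Finite 𝒜] [Nonempty 𝒜]

/-- Finiteness of the alphabet makes the range of `U V` finite, so the supremum is a genuine one and
not the default value for unbounded sets. -/
lemma IsInteraction.abs_le_supNorm (hU : IsInteraction U) (V : Finset ℤ) (σ : ℤ → 𝒜) :
    |U V σ| ≤ supNorm U V := by
  refine le_ciSup (f := fun σ : ℤ → 𝒜 => |U V σ|) ?_ σ
  let f : (V → 𝒜) → ℝ := fun ω =>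
    |U V (Function.updateFinset (fun _ => Classical.arbitrary 𝒜) V ω)|
  refine ((Set.finite_range f).subset ?_).bddAbove
  rintro _ ⟨σ, rfl⟩
  refine ⟨V.restrict σ, ?_⟩
  simp only [f]
  rw [hU.congr]
  intro i hi
  simp [Function.updateFinset, hi]

end Interaction

/-! ### Words on blocks and their conditional law -/

section Gibbs

/-- The translate `C_k + s` of the window. -/
noncomputable def block (s : ℤ) (k : ℕ) : Finset ℤ := Finset.Icc (s + 1) (s + k)

lemma mem_block {s : ℤ} {k : ℕ} {x : ℤ} : x ∈ block s k ↔ s + 1 ≤ x ∧ x ≤ s + k :=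
  Finset.mem_Icc

lemma mem_window {k : ℕ} {x : ℤ} : x ∈ window k ↔ 1 ≤ x ∧ x ≤ k := Finset.mem_Icc

variable {𝒜 : Type*}

/-- The word read off `σ` on the block `C_k + s`. -/
def blockWord (s : ℤ) (k : ℕ) (σ : ℤ → 𝒜) : window k → 𝒜 := fun l => σ (s + l)

/-- The configuration on the block `C_k + s` that spells the word `w`. -/
def placeWord (s : ℤ) {k : ℕ} (w : window k → 𝒜) : block s k → 𝒜 := fun x =>
  w ⟨x - s, mem_window.2 (by have := mem_block.1 x.2; constructor <;> lia)⟩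

lemma blockWord_updateFinset_placeWord (s : ℤ) {k : ℕ} (w : window k → 𝒜) (ζ : ℤ → 𝒜) :
    blockWord s k (Function.updateFinset ζ (block s k) (placeWord s w)) = w := by
  ext l
  have hl := mem_window.1 l.2
  have h : s + (l : ℤ) ∈ block s k := mem_block.2 ⟨by lia, by lia⟩
  simp [blockWord, Function.updateFinset, h, placeWord]

lemma restrict_eq_placeWord_iff (s : ℤ) {k : ℕ} (w : window k → 𝒜) (σ : ℤ → 𝒜) :
    (block s k).restrict σ = placeWord s w ↔ blockWord s k σ = w := by
  constructor
  · intro h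
    ext l
    have hl := mem_window.1 l.2
    have := congrFun h ⟨s + l, mem_block.2 ⟨by lia, by lia⟩⟩
    simpa [blockWord, placeWord] using this
  · rintro rfl
    ext x
    simp [placeWord, blockWord]

lemma placeWord_bijective (s : ℤ) (k : ℕ) :
    Function.Bijective (placeWord s : (window k → 𝒜) → block s k → 𝒜) := by
  constructor
  · intro w w' h
    ext l
    have hl := mem_window.1 l.2
    have := congrFun h ⟨s + l, mem_block.2 ⟨by lia, by lia⟩⟩
    simpa [placeWord] using this
  · intro ω
    refine ⟨fun l => ω ⟨s + l, mem_block.2 (by have := mem_window.1 l.2; constructor <;> lia)⟩, ?_⟩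
    ext x
    simp [placeWord]

lemma measurable_blockWord [MeasurableSpace 𝒜] {Δ : Set ℤ} {s : ℤ} {k : ℕ} (h : ∀ x ∈ block s k, x ∈ Δ) :
    Measurable[cylinderEvents Δ] (blockWord s k : (ℤ → 𝒜) → window k → 𝒜) := by
  refine @measurable_pi_lambda _ _ _ (cylinderEvents Δ) _ _ fun l => ?_
  refine measurable_cylinderEvents_iff.1 (@measurable_id _ (cylinderEvents Δ)) (h _ ?_)
  have := mem_window.1 l.2
  exact mem_block.2 ⟨by lia, by lia⟩

variable [Fintype 𝒜] [Nonempty 𝒜] {U : Finset ℤ → (ℤ → 𝒜) → ℝ}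

/-- The energy of a word on `C_k` with free boundary conditions. -/
noncomputable def wordEnergy (U : Finset ℤ → (ℤ → 𝒜) → ℝ) (k : ℕ) (w : window k → 𝒜) : ℝ :=
  ∑ V ∈ (window k).powerset,
    U V (Function.updateFinset (fun _ => Classical.arbitrary 𝒜) (window k) w)

/-- The free boundary finite-volume Gibbs weight of a word on `C_k`. -/
noncomputable def wordWeight (U : Finset ℤ → (ℤ → 𝒜) → ℝ) (k : ℕ) (w : window k → 𝒜) : ℝ :=
  Real.exp (-wordEnergy U k w) / freePartitionFunction U k

lemma freePartitionFunction_eq (U : Finset ℤ → (ℤ → 𝒜) → ℝ) (k : ℕ) :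
    freePartitionFunction U k = ∑ w, Real.exp (-wordEnergy U k w) := rfl

lemma freePartitionFunction_pos (U : Finset ℤ → (ℤ → 𝒜) → ℝ) (k : ℕ) :
    0 < freePartitionFunction U k := by
  rw [freePartitionFunction_eq]
  exact Finset.sum_pos (fun _ _ => Real.exp_pos _) Finset.univ_nonempty

lemma wordWeight_pos (U : Finset ℤ → (ℤ → 𝒜) → ℝ) {k : ℕ} (w : window k → 𝒜) :
    0 < wordWeight U k w :=
  div_pos (Real.exp_pos _) (freePartitionFunction_pos U k)

lemma sum_wordWeight (U : Finset ℤ → (ℤ → 𝒜) → ℝ) (k : ℕ) :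
    ∑ w, wordWeight U k w = 1 := by
  simp only [wordWeight]
  rw [← Finset.sum_div, ← freePartitionFunction_eq, div_self (freePartitionFunction_pos U k).ne']

variable [MeasurableSpace 𝒜]

omit [Fintype 𝒜] in
lemma IsInteraction.sum_powerset_block (hU : IsInteraction U) (s : ℤ) (k : ℕ) (ξ : ℤ → 𝒜) :
    ∑ V ∈ (block s k).powerset, U V ξ = wordEnergy U k (blockWord s k ξ) := by
  symm
  refine Finset.sum_nbij' (fun V => V.image fun j => j + s) (fun V => V.image fun j => j + -s)
    ?_ ?_ ?_ ?_ ?_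
  · intro V hV
    rw [Finset.mem_powerset] at hV ⊢
    intro x hx
    obtain ⟨y, hy, rfl⟩ := Finset.mem_image.1 hx
    have := mem_window.1 (hV hy)
    exact mem_block.2 ⟨by lia, by lia⟩
  · intro V hV
    rw [Finset.mem_powerset] at hV ⊢
    intro x hx
    obtain ⟨y, hy, rfl⟩ := Finset.mem_image.1 hx
    have := mem_block.1 (hV hy)
    exact mem_window.2 ⟨by lia, by lia⟩
  · intro V _
    simp only [Finset.image_image, Function.comp_def, add_neg_cancel_right, Finset.image_id']
  · intro V _
    simp only [Finset.image_image, Function.comp_def, neg_add_cancel_right, Finset.image_id']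
  · intro V hV
    rw [Finset.mem_powerset] at hV
    rw [← hU.apply_shiftConfig]
    refine hU.congr fun i hi => ?_
    simp [Function.updateFinset, hV hi, blockWord, shiftConfig]

/-- A set that meets the block without lying in it crosses one of the two end cuts, so the boundary
terms sum to at most twice the bound for one cut. The constant `u` is the term of the empty set,
which the free energy includes and the Hamiltonian omits. -/
lemma IsInteraction.exists_abs_hamiltonian_sub_le (hU : IsInteraction U) :
    ∃ D ≥ 0, ∃ u : ℝ, ∀ (s : ℤ) (k : ℕ) (ξ : ℤ → 𝒜),
      |hamiltonian U (block s k) ξ - (wordEnergy U k (blockWord s k ξ) - u)| ≤ D := by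
  classical
  obtain ⟨D, hD, hcross⟩ := hU.exists_sum_crosses_le
  refine ⟨D + D, by linarith, U ∅ (fun _ => Classical.arbitrary 𝒜), fun s k ξ => ?_⟩
  set Λ := block s k with hΛ
  let h : Finset ℤ → ℝ := fun V => if V ∈ Λ.powerset.erase ∅ then U V ξ else 0
  let g : Finset ℤ → ℝ := fun V => if (V ∩ Λ).Nonempty ∧ ¬ V ⊆ Λ then U V ξ else 0
  have hsplit : ({V : Finset ℤ | (V ∩ Λ).Nonempty} : Set (Finset ℤ)).indicator (fun V => U V ξ)
      = fun V => h V + g V := by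
    ext V
    by_cases h1 : (V ∩ Λ).Nonempty
    · have hne : V ≠ ∅ := by rintro rfl; simp at h1
      by_cases h2 : V ⊆ Λ <;> simp [h, g, h1, h2, hne]
    · have : ¬ (V ≠ ∅ ∧ V ⊆ Λ) := by
        rintro ⟨hne, hs⟩
        rw [Finset.inter_eq_left.2 hs] at h1
        exact h1 (Finset.nonempty_iff_ne_empty.2 hne)
      simp only [ne_eq] at this
      simp [h, g, h1, this]
  have hh : HasSum h (∑ V ∈ Λ.powerset.erase ∅, U V ξ) := by
    have : ∑ V ∈ Λ.powerset.erase ∅, U V ξ = ∑ V ∈ Λ.powerset.erase ∅, h V :=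
      Finset.sum_congr rfl fun V hV => by simp only [h, if_pos hV]
    rw [this]
    exact hasSum_sum_of_ne_finset_zero fun V hV => by simp only [h, if_neg hV]
  have hgF : ∀ F : Finset (Finset ℤ), ∑ V ∈ F, |g V| ≤ D + D := by
    intro F
    have hpt : ∀ V ∈ F, |g V| ≤ (if Crosses s V then supNorm U V else 0) +
        (if Crosses (s + k) V then supNorm U V else 0) := by
      intro V _
      have h0 := supNorm_nonneg (U := U) V
      by_cases hc : (V ∩ Λ).Nonempty ∧ ¬ V ⊆ Λ
      · have hle : |g V| ≤ supNorm U V := by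
          simp only [g, if_pos hc]; exact hU.abs_le_supNorm V ξ
        obtain ⟨⟨a, ha⟩, hns⟩ := hc
        obtain ⟨b, hb, hbΛ⟩ := Finset.not_subset.1 hns
        obtain ⟨haV, haΛ⟩ := Finset.mem_inter.1 ha
        rw [hΛ, mem_block] at haΛ hbΛ
        by_cases hbs : b ≤ s
        · have : Crosses s V := ⟨⟨b, hb, hbs⟩, a, haV, by lia⟩
          rw [if_pos this]
          split_ifs <;> linarith
        · have : Crosses (s + k) V := ⟨⟨a, haV, by lia⟩, b, hb, by lia⟩
          rw [if_pos this]
          split_ifs <;> linarith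
      · simp only [g, if_neg hc, abs_zero]
        split_ifs <;> linarith
    refine (Finset.sum_le_sum hpt).trans ?_
    rw [Finset.sum_add_distrib, ← Finset.sum_filter, ← Finset.sum_filter]
    exact add_le_add (hcross s _ fun V hV => (Finset.mem_filter.1 hV).2)
      (hcross (s + k) _ fun V hV => (Finset.mem_filter.1 hV).2)
  have hgs : Summable fun V => |g V| := summable_of_sum_le (fun _ => abs_nonneg _) hgF
  have hham : hamiltonian U Λ ξ = ∑ V ∈ Λ.powerset.erase ∅, U V ξ + ∑' V, g V := by
    unfold hamiltonian
    rw [show (∑' V : {V : Finset ℤ // (V ∩ Λ).Nonempty}, U V ξ)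
      = ∑' V, ({V : Finset ℤ | (V ∩ Λ).Nonempty} : Set (Finset ℤ)).indicator (fun V => U V ξ) V
      from tsum_subtype ({V : Finset ℤ | (V ∩ Λ).Nonempty} : Set (Finset ℤ)) fun V => U V ξ, hsplit,
      hh.summable.tsum_add hgs.of_abs, hh.tsum_eq]
  have hemp : ∑ V ∈ Λ.powerset.erase ∅, U V ξ + U ∅ ξ = ∑ V ∈ Λ.powerset, U V ξ :=
    Finset.sum_erase_add _ _ (Finset.empty_mem_powerset _)
  have hu : U ∅ ξ = U ∅ (fun _ => Classical.arbitrary 𝒜) := hU.congr (by simp)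
  have hfin : hamiltonian U Λ ξ - (wordEnergy U k (blockWord s k ξ)
      - U ∅ (fun _ => Classical.arbitrary 𝒜)) = ∑' V, g V := by
    rw [hham, ← hU.sum_powerset_block, ← hΛ, ← hemp, hu]
    ring
  rw [hfin]
  have habs : |∑' V, g V| ≤ ∑' V, |g V| := by
    simpa [Real.norm_eq_abs] using norm_tsum_le_tsum_norm (f := g) (by simpa using hgs)
  exact habs.trans (hgs.tsum_le_of_sum_le hgF)

/-- Finite-volume Gibbs weights with arbitrary boundary condition are comparable with the free
ones. -/
lemma IsInteraction.exists_gibbsWeight_bounds (hU : IsInteraction U) :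
    ∃ C ≥ 1, ∀ (s : ℤ) (k : ℕ) (ζ : ℤ → 𝒜) (w : window k → 𝒜),
      C⁻¹ * wordWeight U k w ≤ gibbsWeight U (block s k) ζ (placeWord s w) ∧
      gibbsWeight U (block s k) ζ (placeWord s w) ≤ C * wordWeight U k w := by
  obtain ⟨D, hD, u, h⟩ := hU.exists_abs_hamiltonian_sub_le
  -- One factor `exp D` comes from the Boltzmann factor and one from the partition function; the
  -- shift `u` cancels.
  refine ⟨Real.exp (2 * D), Real.one_le_exp (by linarith), fun s k ζ w => ?_⟩
  set e : (window k → 𝒜) → ℝ := fun w =>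
    Real.exp (-hamiltonian U (block s k) (Function.updateFinset ζ (block s k) (placeWord s w)))
    with he
  have hZ : partitionFunction U (block s k) ζ = ∑ w, e w :=
    ((placeWord_bijective s k).sum_comp fun ω : block s k → 𝒜 =>
      Real.exp (-hamiltonian U (block s k) (Function.updateFinset ζ (block s k) ω))).symm
  have hle : ∀ w, e w ≤ Real.exp (D + u) * Real.exp (-wordEnergy U k w) := by
    intro w
    have := abs_le.1 (h s k (Function.updateFinset ζ (block s k) (placeWord s w)))
    rw [blockWord_updateFinset_placeWord] at this
    rw [he, ← Real.exp_add]
    exact Real.exp_le_exp.2 (by linarith)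
  have hge : ∀ w, Real.exp (u - D) * Real.exp (-wordEnergy U k w) ≤ e w := by
    intro w
    have := abs_le.1 (h s k (Function.updateFinset ζ (block s k) (placeWord s w)))
    rw [blockWord_updateFinset_placeWord] at this
    rw [he, ← Real.exp_add]
    exact Real.exp_le_exp.2 (by linarith)
  have hF := freePartitionFunction_pos U k
  have hZle : ∑ w, e w ≤ Real.exp (D + u) * freePartitionFunction U k := by
    rw [freePartitionFunction_eq, Finset.mul_sum]
    exact Finset.sum_le_sum fun w _ => hle w
  have hZge : Real.exp (u - D) * freePartitionFunction U k ≤ ∑ w, e w := by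
    rw [freePartitionFunction_eq, Finset.mul_sum]
    exact Finset.sum_le_sum fun w _ => hge w
  have hZpos : 0 < ∑ w, e w := lt_of_lt_of_le (by positivity) hZge
  have hg : gibbsWeight U (block s k) ζ (placeWord s w) = e w / ∑ w, e w := by
    rw [gibbsWeight, hZ]
  have hexp : Real.exp (2 * D) * Real.exp (u - D) = Real.exp (D + u) := by
    rw [← Real.exp_add]; congr 1; ring
  rw [hg, wordWeight]
  constructor
  · rw [le_div_iff₀ hZpos, inv_mul_eq_div, div_div, div_mul_eq_mul_div,
      div_le_iff₀ (by positivity)]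
    calc Real.exp (-wordEnergy U k w) * ∑ w, e w
        ≤ Real.exp (-wordEnergy U k w) * (Real.exp (D + u) * freePartitionFunction U k) := by
          gcongr
      _ = (Real.exp (u - D) * Real.exp (-wordEnergy U k w)) *
          (freePartitionFunction U k * Real.exp (2 * D)) := by rw [← hexp]; ring
      _ ≤ e w * (freePartitionFunction U k * Real.exp (2 * D)) := by
          gcongr; exact hge w
  · rw [div_le_iff₀ hZpos, mul_div_assoc', div_mul_eq_mul_div, le_div_iff₀ hF]
    calc e w * freePartitionFunction U k
        ≤ Real.exp (D + u) * Real.exp (-wordEnergy U k w) * freePartitionFunction U k := by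
          gcongr; exact hle w
      _ = Real.exp (2 * D) * Real.exp (-wordEnergy U k w) *
          (Real.exp (u - D) * freePartitionFunction U k) := by rw [← hexp]; ring
      _ ≤ _ := by gcongr

variable [MeasurableSingletonClass 𝒜]

/-- Conditionally on the configuration off a block, the word on the block has, up to bounded
factors, the free finite-volume Gibbs distribution. -/
theorem IsGibbsMeasure.exists_measure_blockWord_bounds (hU : IsInteraction U)
    {μ : Measure (ℤ → 𝒜)} [IsProbabilityMeasure μ] (hμ : IsGibbsMeasure U μ) :
    ∃ C ≥ 1, ∀ (s : ℤ) (k : ℕ) (w : window k → 𝒜) (B : Set (ℤ → 𝒜)),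
      MeasurableSet[cylinderEvents ((block s k : Set ℤ)ᶜ)] B →
      C⁻¹ * wordWeight U k w * μ.real B ≤ μ.real ({σ | blockWord s k σ = w} ∩ B) ∧
      μ.real ({σ | blockWord s k σ = w} ∩ B) ≤ C * wordWeight U k w * μ.real B := by
  obtain ⟨C, hC, h⟩ := hU.exists_gibbsWeight_bounds
  refine ⟨C, hC, fun s k w B hB => ?_⟩
  have hm : cylinderEvents (X := fun _ : ℤ => 𝒜) ((block s k : Set ℤ)ᶜ) ≤ MeasurableSpace.pi :=
    cylinderEvents_le_pi
  have hset : {σ : ℤ → 𝒜 | (block s k).restrict σ = placeWord s w}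
      = {σ | blockWord s k σ = w} := by
    ext σ; exact restrict_eq_placeWord_iff s w σ
  have hmeas : MeasurableSet {σ : ℤ → 𝒜 | blockWord s k σ = w} := by
    refine measurableSet_eq_fun ?_ measurable_const
    exact (measurable_blockWord (Δ := Set.univ) (by simp)).mono cylinderEvents_le_pi le_rfl
  have hae := hμ (block s k) (placeWord s w)
  rw [hset] at hae
  have hint : Integrable ({σ : ℤ → 𝒜 | blockWord s k σ = w}.indicator fun _ => (1 : ℝ)) μ :=
    (integrable_const _).indicator hmeas
  -- The pointwise bounds on the conditional probability are integrated over `B`, which lies in the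
  -- conditioning σ-algebra.
  have key := setIntegral_condExp hm hint hB
  rw [setIntegral_indicator hmeas, setIntegral_const, smul_eq_mul, mul_one, Set.inter_comm] at key
  rw [← key]
  constructor
  · calc C⁻¹ * wordWeight U k w * μ.real B = ∫ _ in B, C⁻¹ * wordWeight U k w ∂μ := by
          rw [setIntegral_const, smul_eq_mul]; ring
      _ ≤ _ := by
          refine setIntegral_mono_ae (integrable_const _).integrableOn
            integrable_condExp.integrableOn ?_
          filter_upwards [hae] with ζ hζ
          rw [hζ]
          exact (h s k ζ w).1
  · calc _ ≤ ∫ _ in B, C * wordWeight U k w ∂μ := by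
          refine setIntegral_mono_ae integrable_condExp.integrableOn
            (integrable_const _).integrableOn ?_
          filter_upwards [hae] with ζ hζ
          rw [hζ]
          exact (h s k ζ w).2
      _ = _ := by rw [setIntegral_const, smul_eq_mul]; ring

end Gibbs

/-! ### Pressure, two-replica sums and maximal weights -/

section Pressure

/-- A quasi-additive sequence stays within bounded distance of a linear one. -/
lemma exists_tendsto_of_quasiadditive {a : ℕ → ℝ} {D : ℝ}
    (h : ∀ m n, |a (m + n) - a m - a n| ≤ D) :
    ∃ L, Tendsto (fun n : ℕ => (1 / (n : ℝ)) * a n) atTop (𝓝 L) ∧ ∀ n : ℕ, |a n - n * L| ≤ D := by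
  have hD : 0 ≤ D := (abs_nonneg _).trans (h 0 0)
  have hlin : ∀ n : ℕ, |a (n + 1)| ≤ (n + 1) * (|a 1| + D) := by
    intro n
    induction n with
    | zero => simpa using hD
    | succ n ih =>
      have h1 := abs_le.1 (h (n + 1) 1)
      have h2 := abs_le.1 ih
      have h3 := neg_abs_le (a 1)
      have h4 := le_abs_self (a 1)
      push_cast
      rw [abs_le]
      constructor <;> linarith
  have hbd : ∀ n : ℕ, |a n| / n ≤ |a 1| + D := by
    rintro (_ | n)
    · simp; positivity
    · rw [div_le_iff₀ (by positivity), mul_comm]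
      simpa using hlin n
  -- Both `a + D` and `-a + D` are subadditive. Fekete's lemma applies to each, the two limits are
  -- opposite, and each limit being an infimum gives one side of the estimate.
  have hu : Subadditive fun n => a n + D := fun m n => by
    have := (abs_le.1 (h m n)).2
    linarith
  have hv : Subadditive fun n => -a n + D := fun m n => by
    have := (abs_le.1 (h m n)).1
    linarith
  have hub : BddBelow (Set.range fun n : ℕ => (a n + D) / n) := by
    refine ⟨-(|a 1| + D), ?_⟩
    rintro _ ⟨n, rfl⟩
    have h1 : -|a n| / n ≤ (a n + D) / n := by
      gcongr; linarith [neg_abs_le (a n)]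
    have := hbd n
    rw [neg_div] at h1
    simp only; linarith
  have hvb : BddBelow (Set.range fun n : ℕ => (-a n + D) / n) := by
    refine ⟨-(|a 1| + D), ?_⟩
    rintro _ ⟨n, rfl⟩
    have h1 : -|a n| / n ≤ (-a n + D) / n := by
      gcongr; linarith [le_abs_self (a n)]
    have := hbd n
    rw [neg_div] at h1
    simp only; linarith
  have hDn : Tendsto (fun n : ℕ => D / (n : ℝ)) atTop (𝓝 0) :=
    tendsto_const_div_atTop_nhds_zero_nat D
  have ht : Tendsto (fun n : ℕ => (1 / (n : ℝ)) * a n) atTop (𝓝 hu.lim) := by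
    have := (hu.tendsto_lim hub).sub hDn
    rw [sub_zero] at this
    refine this.congr fun n => ?_
    ring
  have ht' : Tendsto (fun n : ℕ => (1 / (n : ℝ)) * a n) atTop (𝓝 (-hv.lim)) := by
    have := ((hv.tendsto_lim hvb).sub hDn).neg
    rw [sub_zero] at this
    refine this.congr fun n => ?_
    ring
  have hL := tendsto_nhds_unique ht ht'
  refine ⟨hu.lim, ht, fun n => ?_⟩
  rcases eq_or_ne n 0 with rfl | hn
  · have := h 0 0
    simp only [add_zero, sub_self, zero_sub, abs_neg] at this
    simpa using this
  · have hn' : (0 : ℝ) < n := by positivity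
    have h1 := hu.lim_le_div hub hn
    have h2 := hv.lim_le_div hvb hn
    rw [le_div_iff₀ hn'] at h1 h2
    rw [show hv.lim = -hu.lim by rw [hL]; ring] at h2
    rw [abs_le]
    constructor <;> linarith

variable {𝒜 : Type*}

/-- The initial and the final part of a word. -/
def splitWord (k l : ℕ) (w : window (k + l) → 𝒜) : (window k → 𝒜) × (window l → 𝒜) :=
  (fun x => w ⟨x, mem_window.2 (by have := mem_window.1 x.2; constructor <;> lia)⟩,
   fun x => w ⟨k + x, mem_window.2 (by have := mem_window.1 x.2; constructor <;> lia)⟩)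

lemma splitWord_bijective (k l : ℕ) :
    Function.Bijective (splitWord k l : (window (k + l) → 𝒜) → _) := by
  constructor
  · intro w w' h
    have h1 := congrArg Prod.fst h
    have h2 := congrArg Prod.snd h
    ext x
    have hx := mem_window.1 x.2
    by_cases hxk : (x : ℤ) ≤ k
    · exact congrFun h1 ⟨x, mem_window.2 ⟨hx.1, hxk⟩⟩
    · have := congrFun h2 ⟨x - k, mem_window.2 ⟨by lia, by lia⟩⟩
      simpa [splitWord] using this
  · rintro ⟨u, v⟩
    refine ⟨fun x => if hx : (x : ℤ) ≤ k then u ⟨x, mem_window.2 ⟨(mem_window.1 x.2).1, hx⟩⟩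
      else v ⟨x - k, mem_window.2 (by have := mem_window.1 x.2; constructor <;> lia)⟩, ?_⟩
    refine Prod.ext ?_ ?_
    · ext x
      have hx := mem_window.1 x.2
      simp only [splitWord]
      rw [dif_pos hx.2]
    · ext x
      have hx := mem_window.1 x.2
      simp only [splitWord]
      rw [dif_neg (by lia)]
      congr 2
      lia

variable [Fintype 𝒜] [Nonempty 𝒜] {U : Finset ℤ → (ℤ → 𝒜) → ℝ} [MeasurableSpace 𝒜]

/-- The sets lying in neither half cross the cut at `k`. The empty set lies in both halves and is
counted twice, whence the extra `|u|`. -/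
lemma IsInteraction.exists_abs_wordEnergy_split_le (hU : IsInteraction U) :
    ∃ D ≥ 0, ∀ (k l : ℕ) (w : window (k + l) → 𝒜),
      |wordEnergy U (k + l) w - (wordEnergy U k (splitWord k l w).1
        + wordEnergy U l (splitWord k l w).2)| ≤ D := by
  classical
  obtain ⟨D, hD, hcross⟩ := hU.exists_sum_crosses_le
  set u := U ∅ (fun _ => Classical.arbitrary 𝒜)
  refine ⟨D + |u|, by positivity, fun k l w => ?_⟩
  set ξ := Function.updateFinset (fun _ => Classical.arbitrary 𝒜) (window (k + l)) w with hξ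
  have e0 : blockWord 0 (k + l) ξ = w := by
    ext x
    have hx := x.2
    simp [blockWord, hξ, Function.updateFinset]
  have e1 : blockWord 0 k ξ = (splitWord k l w).1 := by
    ext x
    have hx := mem_window.1 x.2
    have : (x : ℤ) ∈ window (k + l) := mem_window.2 ⟨by lia, by lia⟩
    simp [blockWord, hξ, Function.updateFinset, splitWord, this]
  have e2 : blockWord k l ξ = (splitWord k l w).2 := by
    ext x
    have hx := mem_window.1 x.2
    have : (k : ℤ) + (x : ℤ) ∈ window (k + l) := mem_window.2 ⟨by lia, by lia⟩
    simp [blockWord, hξ, Function.updateFinset, splitWord, this]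
  rw [← e1, ← e2]
  nth_rw 1 [← e0]
  rw [← hU.sum_powerset_block, ← hU.sum_powerset_block, ← hU.sum_powerset_block]
  set P := (block 0 (k + l)).powerset
  set P1 := (block 0 k).powerset
  set P2 := (block k l).powerset
  have hsub : P1 ∪ P2 ⊆ P := by
    refine Finset.union_subset (Finset.powerset_mono.2 ?_) (Finset.powerset_mono.2 ?_) <;>
    · intro x hx
      rw [mem_block] at hx ⊢
      push_cast
      constructor <;> lia
  have hinter : P1 ∩ P2 = {∅} := by
    ext V
    simp only [P1, P2, Finset.mem_inter, Finset.mem_powerset, Finset.mem_singleton]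
    constructor
    · rintro ⟨h1, h2⟩
      refine Finset.eq_empty_of_forall_notMem fun x hx => ?_
      have := mem_block.1 (h1 hx)
      have := mem_block.1 (h2 hx)
      lia
    · rintro rfl; simp
  have hu : U ∅ ξ = u := hU.congr (by simp)
  have h1 : ∑ V ∈ P1 ∪ P2, U V ξ + u = ∑ V ∈ P1, U V ξ + ∑ V ∈ P2, U V ξ := by
    rw [← Finset.sum_union_inter, hinter, Finset.sum_singleton, hu]
  have h2 : ∑ V ∈ P \ (P1 ∪ P2), U V ξ + ∑ V ∈ P1 ∪ P2, U V ξ = ∑ V ∈ P, U V ξ :=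
    Finset.sum_sdiff hsub
  have h3 : |∑ V ∈ P \ (P1 ∪ P2), U V ξ| ≤ D := by
    refine (Finset.abs_sum_le_sum_abs _ _).trans
      ((Finset.sum_le_sum fun V _ => hU.abs_le_supNorm V ξ).trans (hcross k _ fun V hV => ?_))
    rw [Finset.mem_sdiff, Finset.mem_union, not_or] at hV
    obtain ⟨hV, hV1, hV2⟩ := hV
    rw [Finset.mem_powerset] at hV hV1 hV2
    obtain ⟨a, ha, ha'⟩ := Finset.not_subset.1 hV1
    obtain ⟨b, hb, hb'⟩ := Finset.not_subset.1 hV2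
    have h1 := mem_block.1 (hV ha)
    have h2 := mem_block.1 (hV hb)
    rw [mem_block] at ha' hb'
    push_cast at h1 h2
    exact ⟨⟨b, hb, by lia⟩, a, ha, by lia⟩
  have h4 : ∑ V ∈ P, U V ξ - (∑ V ∈ P1, U V ξ + ∑ V ∈ P2, U V ξ)
      = ∑ V ∈ P \ (P1 ∪ P2), U V ξ - u := by linarith
  rw [h4]
  exact (abs_sub _ _).trans (by linarith)

lemma IsInteraction.exists_log_sum_quasiadditive (hU : IsInteraction U) {β : ℝ} (hβ : 0 ≤ β) :
    ∃ D ≥ 0, ∀ k l : ℕ,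
      |Real.log (∑ w, Real.exp (-(β * wordEnergy U (k + l) w)))
        - Real.log (∑ w, Real.exp (-(β * wordEnergy U k w)))
        - Real.log (∑ w, Real.exp (-(β * wordEnergy U l w)))| ≤ D := by
  obtain ⟨D, hD, h⟩ := hU.exists_abs_wordEnergy_split_le
  refine ⟨β * D, by positivity, fun k l => ?_⟩
  have hpos : ∀ k, 0 < ∑ w, Real.exp (-(β * wordEnergy U k w)) := fun k =>
    Finset.sum_pos (fun _ _ => Real.exp_pos _) Finset.univ_nonempty
  set Z := ∑ w, Real.exp (-(β * wordEnergy U k w)) with hZ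
  set Z' := ∑ w, Real.exp (-(β * wordEnergy U l w)) with hZ'
  have hprod : Z * Z' = ∑ w : window (k + l) → 𝒜,
      Real.exp (-(β * wordEnergy U k (splitWord k l w).1))
        * Real.exp (-(β * wordEnergy U l (splitWord k l w).2)) := by
    rw [hZ, hZ', Finset.sum_mul_sum, ← Fintype.sum_prod_type']
    exact ((splitWord_bijective k l).sum_comp
      fun p : (window k → 𝒜) × (window l → 𝒜) => Real.exp (-(β * wordEnergy U k p.1))
        * Real.exp (-(β * wordEnergy U l p.2))).symm
  have hle : ∑ w, Real.exp (-(β * wordEnergy U (k + l) w)) ≤ Real.exp (β * D) * (Z * Z') := by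
    rw [hprod, Finset.mul_sum]
    refine Finset.sum_le_sum fun w _ => ?_
    rw [← Real.exp_add, ← Real.exp_add]
    refine Real.exp_le_exp.2 ?_
    nlinarith [(abs_le.1 (h k l w)).1]
  have hge : Real.exp (-(β * D)) * (Z * Z') ≤ ∑ w, Real.exp (-(β * wordEnergy U (k + l) w)) := by
    rw [hprod, Finset.mul_sum]
    refine Finset.sum_le_sum fun w _ => ?_
    rw [← Real.exp_add, ← Real.exp_add]
    refine Real.exp_le_exp.2 ?_
    nlinarith [(abs_le.1 (h k l w)).2]
  have hZZ : 0 < Z * Z' := mul_pos (hpos k) (hpos l)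
  have l1 := Real.log_le_log (hpos (k + l)) hle
  have l2 := Real.log_le_log (by positivity) hge
  rw [Real.log_mul (Real.exp_pos _).ne' hZZ.ne', Real.log_exp,
    Real.log_mul (hpos k).ne' (hpos l).ne'] at l1 l2
  rw [abs_le]
  constructor <;> linarith

omit [Fintype 𝒜] [MeasurableSpace 𝒜] in
lemma wordEnergy_two_smul (k : ℕ) (w : window k → 𝒜) :
    wordEnergy ((2 : ℝ) • U) k w = 2 * wordEnergy U k w := by
  simp [wordEnergy, Finset.mul_sum]

lemma IsInteraction.exists_abs_log_freePartitionFunction_le (hU : IsInteraction U) :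
    ∃ D ≥ 0, ∀ k : ℕ, |Real.log (freePartitionFunction U k) - k * pressure U| ≤ D ∧
      |Real.log (freePartitionFunction ((2 : ℝ) • U) k) - k * pressure ((2 : ℝ) • U)| ≤ D := by
  obtain ⟨D₁, hD₁, h₁⟩ := hU.exists_log_sum_quasiadditive zero_le_one
  obtain ⟨D₂, hD₂, h₂⟩ := hU.exists_log_sum_quasiadditive zero_le_two
  have z₁ : ∀ k, ∑ w, Real.exp (-(1 * wordEnergy U k w)) = freePartitionFunction U k := fun k => by
    simp only [one_mul, freePartitionFunction_eq]
  have z₂ : ∀ k, ∑ w, Real.exp (-(2 * wordEnergy U k w))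
      = freePartitionFunction ((2 : ℝ) • U) k := fun k => by
    simp only [wordEnergy_two_smul, freePartitionFunction_eq]
  simp only [z₁] at h₁
  simp only [z₂] at h₂
  obtain ⟨L₁, t₁, b₁⟩ := exists_tendsto_of_quasiadditive
    (a := fun k => Real.log (freePartitionFunction U k)) h₁
  obtain ⟨L₂, t₂, b₂⟩ := exists_tendsto_of_quasiadditive
    (a := fun k => Real.log (freePartitionFunction ((2 : ℝ) • U) k)) h₂
  have p₁ : pressure U = L₁ := t₁.limUnder_eq
  have p₂ : pressure ((2 : ℝ) • U) = L₂ := t₂.limUnder_eq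
  refine ⟨max D₁ D₂, le_max_of_le_left hD₁, fun k => ⟨?_, ?_⟩⟩
  · rw [p₁]; exact (b₁ k).trans (le_max_left _ _)
  · rw [p₂]; exact (b₂ k).trans (le_max_right _ _)

/-- The sum equals `Z_k(2U) / Z_k(U)^2`. Each logarithm is linear in `k` up to `D`, and one of them
enters twice, hence the constant `exp (3D)`. -/
lemma IsInteraction.exists_sum_sq_wordWeight_bounds (hU : IsInteraction U) :
    ∃ C ≥ 1, ∀ k : ℕ, C⁻¹ * Real.exp (-(2 * alpha U * k)) ≤ ∑ w, wordWeight U k w ^ 2 ∧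
      ∑ w, wordWeight U k w ^ 2 ≤ C * Real.exp (-(2 * alpha U * k)) := by
  obtain ⟨D, hD, h⟩ := hU.exists_abs_log_freePartitionFunction_le
  refine ⟨Real.exp (3 * D), Real.one_le_exp (by linarith), fun k => ?_⟩
  have h1 := freePartitionFunction_pos U k
  have h2 := freePartitionFunction_pos ((2 : ℝ) • U) k
  have hS : ∑ w, wordWeight U k w ^ 2 = Real.exp (Real.log (freePartitionFunction ((2 : ℝ) • U) k)
      - 2 * Real.log (freePartitionFunction U k)) := by
    rw [Real.exp_sub, Real.exp_log h2, two_mul, Real.exp_add, Real.exp_log h1,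
      freePartitionFunction_eq ((2 : ℝ) • U), Finset.sum_div]
    refine Finset.sum_congr rfl fun w _ => ?_
    rw [wordWeight, div_pow, wordEnergy_two_smul, ← Real.exp_nat_mul, sq]
    congr 2
    push_cast; ring
  obtain ⟨a, b⟩ := h k
  rw [abs_le] at a b
  rw [hS, ← Real.exp_neg, ← Real.exp_add, ← Real.exp_add, Real.exp_le_exp, Real.exp_le_exp, alpha]
  constructor <;> nlinarith

/-- Replacing the letters of `w` on a set `S` of sites by different ones raises the energy by at
most `2A|S|`. Different `S` give different words, so the squared weights of these words add up, by
the binomial theorem, to at least `(1 + exp (-4A))^k` times that of `w`. -/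
lemma IsInteraction.exists_wordWeight_sq_mul_le [Nontrivial 𝒜] (hU : IsInteraction U) :
    ∃ x > 0, ∀ (k : ℕ) (w : window k → 𝒜),
      wordWeight U k w ^ 2 * (1 + x) ^ k ≤ ∑ w, wordWeight U k w ^ 2 := by
  classical
  obtain ⟨A, hA, h⟩ := hU.exists_sum_mem_le
  refine ⟨Real.exp (-(4 * A)), Real.exp_pos _, fun k w => ?_⟩
  choose f hf using fun a : 𝒜 => exists_ne a
  let flip : Finset ℤ → window k → 𝒜 := fun S l => if (l : ℤ) ∈ S then f (w l) else w l
  have hinj : Set.InjOn flip ((window k).powerset : Set (Finset ℤ)) := by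
    intro S hS T hT hST
    simp only [Finset.coe_powerset, Set.mem_preimage, Set.mem_powerset_iff,
      Finset.coe_subset] at hS hT
    ext i
    by_cases hi : i ∈ window k
    · have := congrFun hST ⟨i, hi⟩
      simp only [flip] at this
      by_cases h1 : i ∈ S <;> by_cases h2 : i ∈ T <;> simp only [h1, h2, if_true, if_false] at this ⊢
      · exact absurd this (hf _)
      · exact absurd this.symm (hf _)
    · exact ⟨fun h => absurd (hS h) hi, fun h => absurd (hT h) hi⟩
  have henergy : ∀ S : Finset ℤ, wordEnergy U k (flip S) ≤ wordEnergy U k w + 2 * A * S.card := by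
    intro S
    set ξ := Function.updateFinset (fun _ => Classical.arbitrary 𝒜) (window k) w with hξ
    set ξ' := Function.updateFinset (fun _ => Classical.arbitrary 𝒜) (window k) (flip S) with hξ'
    have hV : ∀ V ∈ (window k).powerset,
        U V ξ' ≤ U V ξ + ∑ i ∈ S, if i ∈ V then 2 * supNorm U V else 0 := by
      intro V _
      have h0 := supNorm_nonneg (U := U) V
      have hnn : ∀ i ∈ S, 0 ≤ if i ∈ V then 2 * supNorm U V else 0 := fun i _ => by
        split_ifs <;> linarith
      by_cases hVS : ∃ i ∈ S, i ∈ V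
      · obtain ⟨i, hiS, hiV⟩ := hVS
        have h1 := Finset.single_le_sum hnn hiS
        rw [if_pos hiV] at h1
        have h2 := abs_le.1 (hU.abs_le_supNorm V ξ)
        have h3 := abs_le.1 (hU.abs_le_supNorm V ξ')
        linarith
      · push Not at hVS
        have : U V ξ' = U V ξ := hU.congr fun i hi => by
          have hiS : i ∉ S := fun h => hVS i h hi
          simp [hξ, hξ', Function.updateFinset, flip, hiS]
        rw [this]
        linarith [Finset.sum_nonneg hnn]
    calc wordEnergy U k (flip S) ≤ ∑ V ∈ (window k).powerset,
          (U V ξ + ∑ i ∈ S, if i ∈ V then 2 * supNorm U V else 0) := Finset.sum_le_sum hV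
      _ = wordEnergy U k w + ∑ i ∈ S, ∑ V ∈ (window k).powerset with i ∈ V, 2 * supNorm U V := by
          rw [Finset.sum_add_distrib, Finset.sum_comm]
          simp only [Finset.sum_filter]
          rfl
      _ ≤ wordEnergy U k w + ∑ i ∈ S, 2 * A := by
          gcongr with i hi
          rw [← Finset.mul_sum]
          have := h i ((window k).powerset.filter (i ∈ ·)) fun V hV => (Finset.mem_filter.1 hV).2
          linarith
      _ = _ := by rw [Finset.sum_const, nsmul_eq_mul]; ring
  have hweight : ∀ S : Finset ℤ, wordWeight U k w ^ 2 * Real.exp (-(4 * A)) ^ S.card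
      ≤ wordWeight U k (flip S) ^ 2 := by
    intro S
    rw [wordWeight, wordWeight, div_pow, div_pow, div_mul_eq_mul_div, ← Real.exp_nat_mul,
      ← Real.exp_nat_mul, ← Real.exp_nat_mul, ← Real.exp_add]
    refine div_le_div_of_nonneg_right (Real.exp_le_exp.2 ?_) (sq_nonneg _)
    push_cast
    linarith [henergy S]
  have hcard : (window k).card = k := by simp [window]
  calc wordWeight U k w ^ 2 * (1 + Real.exp (-(4 * A))) ^ k
      = ∑ S ∈ (window k).powerset, wordWeight U k w ^ 2 * Real.exp (-(4 * A)) ^ S.card := by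
        have := Finset.sum_pow_mul_eq_add_pow (Real.exp (-(4 * A))) 1 (window k)
        simp only [one_pow, mul_one, hcard] at this
        rw [← Finset.mul_sum, this, add_comm]
    _ ≤ ∑ S ∈ (window k).powerset, wordWeight U k (flip S) ^ 2 :=
        Finset.sum_le_sum fun S _ => hweight S
    _ = ∑ w' ∈ (window k).powerset.image flip, wordWeight U k w' ^ 2 :=
        (Finset.sum_image (f := fun w' => wordWeight U k w' ^ 2) hinj).symm
    _ ≤ _ := Finset.sum_le_sum_of_subset_of_nonneg (Finset.subset_univ _)
        fun _ _ _ => sq_nonneg _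

/-- The two-replica weight decays at rate exactly `2α`, and the maximal weight at a rate
strictly larger than `α`. -/
theorem IsInteraction.exists_wordWeight_bounds [Nontrivial 𝒜] (hU : IsInteraction U) :
    ∃ c > 0, ∃ C ≥ 1, c ≤ alpha U ∧ ∀ k : ℕ,
      C⁻¹ * Real.exp (-(2 * alpha U * k)) ≤ ∑ w, wordWeight U k w ^ 2 ∧
      ∑ w, wordWeight U k w ^ 2 ≤ C * Real.exp (-(2 * alpha U * k)) ∧
      ∀ w, wordWeight U k w ≤ C * Real.exp (-((alpha U + c) * k)) := by
  obtain ⟨C, hC, hS⟩ := hU.exists_sum_sq_wordWeight_bounds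
  obtain ⟨x, hx, hM⟩ := hU.exists_wordWeight_sq_mul_le
  set c := Real.log (1 + x) / 2 with hc
  have hc0 : 0 < c := half_pos (Real.log_pos (by linarith))
  have hmax : ∀ k (w : window k → 𝒜), wordWeight U k w ≤ C * Real.exp (-((alpha U + c) * k)) := by
    intro k w
    have hpow : (1 + x) ^ k = Real.exp (2 * c * k) := by
      rw [hc, mul_div_cancel₀ _ two_ne_zero, mul_comm, Real.exp_nat_mul,
        Real.exp_log (by linarith)]
    have h1 := (hM k w).trans (hS k).2
    rw [hpow, ← le_div_iff₀ (Real.exp_pos _), mul_div_assoc, ← Real.exp_sub] at h1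
    refine (sq_le_sq₀ (wordWeight_pos U w).le (by positivity)).1 (h1.trans ?_)
    rw [mul_pow, ← Real.exp_nat_mul]
    refine mul_le_mul (by nlinarith) (Real.exp_le_exp.2 ?_) (Real.exp_pos _).le (by positivity)
    push_cast
    linarith
  refine ⟨c, hc0, C, hC, ?_, fun k => ⟨(hS k).1, (hS k).2, hmax k⟩⟩
  -- As the weights sum to one, the sum of squares is at most the maximal weight. Thus `exp (-2αk) ≤
  -- C^2 exp (-(α+c)k)` for all `k`, which is impossible for large `k` if `α < c`.
  by_contra! hlt
  obtain ⟨k, hk⟩ := exists_nat_gt (C ^ 2 / (c - alpha U))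
  rw [div_lt_iff₀ (by linarith)] at hk
  have hle : ∑ w, wordWeight U k w ^ 2 ≤ C * Real.exp (-((alpha U + c) * k)) := by
    calc ∑ w, wordWeight U k w ^ 2
        ≤ ∑ w, C * Real.exp (-((alpha U + c) * k)) * wordWeight U k w :=
          Finset.sum_le_sum fun w _ => by
            rw [sq]; exact mul_le_mul_of_nonneg_right (hmax k w) (wordWeight_pos U w).le
      _ = _ := by rw [← Finset.mul_sum, sum_wordWeight, mul_one]
  have h1 := (hS k).1.trans hle
  rw [inv_mul_le_iff₀ (by linarith), ← mul_assoc, ← sq] at h1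
  have h2 : Real.exp ((c - alpha U) * k) ≤ C ^ 2 := by
    have h3 : Real.exp (-(2 * alpha U * k))
        = Real.exp ((c - alpha U) * k) * Real.exp (-((alpha U + c) * k)) := by
      rw [← Real.exp_add]; congr 1; ring
    rw [h3] at h1
    exact le_of_mul_le_mul_right h1 (Real.exp_pos _)
  have h4 := Real.add_one_le_exp ((c - alpha U) * k)
  linarith

end Pressure

/-! ### Match events and the estimates required of the measure -/

section Matches

variable {𝒜 : Type*}

/-- The event that the patterns of length `k` at the positions `i` and `j` coincide. -/
def matchSet (i j : ℤ) (k : ℕ) : Set (ℤ → 𝒜) :=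
  {σ | ∀ l ∈ window k, shiftConfig i σ l = shiftConfig j σ l}

lemma matchSet_comm (i j : ℤ) (k : ℕ) : (matchSet i j k : Set (ℤ → 𝒜)) = matchSet j i k := by
  ext σ
  exact ⟨fun h l hl => (h l hl).symm, fun h l hl => (h l hl).symm⟩

lemma blockWord_eq_blockWord_iff {i j : ℤ} {k : ℕ} {σ : ℤ → 𝒜} :
    blockWord i k σ = blockWord j k σ ↔ σ ∈ matchSet i j k := by
  constructor
  · exact fun h l hl => congrFun h ⟨l, hl⟩
  · exact fun h => funext fun l => h l l.2

/-- If `σ` agrees on a block with its translate by `d`, each letter of the block is a copy of a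
letter to the right of the block. -/
lemma exists_copy_of_overlap (i d : ℤ) (hd : 0 < d) (k : ℕ) :
    ∃ r : ℤ → ℤ, (∀ l ∈ window k, r l ∉ block i k) ∧
      (matchSet i (i + d) k : Set (ℤ → 𝒜)) ⊆ {σ | ∀ l ∈ window k, σ (i + l) = σ (r l)} := by
  -- The site `r l` is the first point beyond the block on the progression from `i + l` with step
  -- `d`; agreement with the translate carries the letter along this progression.
  refine ⟨fun l => i + l + d * ((k - l) / d + 1), fun l hl h => ?_, fun σ hσ l hl => ?_⟩
  · have h1 := (mem_block.1 h).2
    have h2 := Int.lt_ediv_add_one_mul_self (k - l) hd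
    rw [mul_comm] at h2
    lia
  · have hl' := mem_window.1 hl
    have h0 : 0 ≤ (k - l) / d := Int.ediv_nonneg (by lia) hd.le
    have key : ∀ m : ℕ, (m : ℤ) ≤ (k - l) / d + 1 → σ (i + l) = σ (i + l + d * m) := by
      intro m
      induction m with
      | zero => simp
      | succ m ih =>
        intro hm
        push_cast at hm
        rw [ih (by lia)]
        have h1 : d * (m : ℤ) ≤ k - l := by
          have := Int.mul_ediv_self_le (x := k - l) (k := d) hd.ne'
          nlinarith
        have := hσ (l + d * m) (mem_window.2 ⟨by nlinarith [Int.natCast_nonneg m], by lia⟩)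
        simp only [shiftConfig] at this
        rw [show i + l + d * (m : ℤ) = i + (l + d * m) by ring, this]
        congr 1
        push_cast
        ring
    have := key ((k - l) / d + 1).toNat (by rw [Int.toNat_of_nonneg (by lia)])
    rw [Int.toNat_of_nonneg (by lia)] at this
    exact this

variable [MeasurableSpace 𝒜]

/-- Bounds for matches of separated blocks and for copies of letters, given the configuration
elsewhere. -/
structure MatchEstimates (μ : Measure (ℤ → 𝒜)) (α c C : ℝ) : Prop where
  c_pos : 0 < c
  c_le : c ≤ α
  one_le : 1 ≤ C
  lower : ∀ (i j : ℤ) (k : ℕ) (B : Set (ℤ → 𝒜)), Disjoint (block i k) (block j k) →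
    MeasurableSet[cylinderEvents ((block i k ∪ block j k : Finset ℤ) : Set ℤ)ᶜ] B →
      C⁻¹ * Real.exp (-(2 * α * k)) * μ.real B ≤ μ.real (matchSet i j k ∩ B)
  upper : ∀ (i j : ℤ) (k : ℕ) (B : Set (ℤ → 𝒜)), Disjoint (block i k) (block j k) →
    MeasurableSet[cylinderEvents ((block i k ∪ block j k : Finset ℤ) : Set ℤ)ᶜ] B →
      μ.real (matchSet i j k ∩ B) ≤ C * Real.exp (-(2 * α * k)) * μ.real B
  copy : ∀ (s : ℤ) (b : ℕ) (r : ℤ → ℤ) (B : Set (ℤ → 𝒜)),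
    (∀ l ∈ window b, r l ∉ block s b) → MeasurableSet[cylinderEvents (block s b : Set ℤ)ᶜ] B →
      μ.real ({σ | ∀ l ∈ window b, σ (s + l) = σ (r l)} ∩ B)
        ≤ C * Real.exp (-((α + c) * b)) * μ.real B

lemma measureReal_eq_sum_fiber {Ω W : Type*} [MeasurableSpace Ω] [Fintype W] [MeasurableSpace W]
    [MeasurableSingletonClass W] (μ : Measure Ω) [IsFiniteMeasure μ] {f : Ω → W}
    (hf : Measurable f) {A : Set Ω} (hA : MeasurableSet A) :
    μ.real A = ∑ w, μ.real ({x | f x = w} ∩ A) := by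
  have hm : ∀ w, MeasurableSet ({x | f x = w} ∩ A) := fun w =>
    (hf (measurableSet_singleton w)).inter hA
  rw [← measureReal_biUnion_finset (fun w _ w' _ h => ?_) fun w _ => hm w]
  · congr 1
    ext x
    simp
  · refine Set.disjoint_left.2 fun x hx hx' => h ?_
    rw [← hx.1, ← hx'.1]

variable [Finite 𝒜] [MeasurableSingletonClass 𝒜]

lemma measurableSet_matchSet {Δ : Set ℤ} {i j : ℤ} {k : ℕ} (hi : ∀ x ∈ block i k, x ∈ Δ)
    (hj : ∀ x ∈ block j k, x ∈ Δ) :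
    MeasurableSet[cylinderEvents Δ] (matchSet i j k : Set (ℤ → 𝒜)) := by
  have : (matchSet i j k : Set (ℤ → 𝒜)) = {σ | blockWord i k σ = blockWord j k σ} := by
    ext σ; exact blockWord_eq_blockWord_iff.symm
  rw [this]
  have := Fintype.ofFinite 𝒜
  exact @measurableSet_eq_fun _ _ (cylinderEvents Δ) _ _ _ _
    (measurable_blockWord hi) (measurable_blockWord hj)

lemma measurableSet_matchSet_pi (i j : ℤ) (k : ℕ) :
    MeasurableSet (matchSet i j k : Set (ℤ → 𝒜)) :=
  cylinderEvents_le_pi _ (measurableSet_matchSet (Δ := Set.univ) (by simp) (by simp))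

end Matches

/-! ### Gibbs measures satisfy the match estimates -/

section Gibbs

variable {𝒜 : Type*} [Fintype 𝒜] [Nontrivial 𝒜] [MeasurableSpace 𝒜] [MeasurableSingletonClass 𝒜]
  {U : Finset ℤ → (ℤ → 𝒜) → ℝ}

/-- For disjoint blocks, the common word `w` is fixed and the one-block bound is used twice, so that
`wordWeight U k w ^ 2` is summed over `w`. For copies, the letters off the block determine the word
required on it, whose probability is at most the maximal weight. -/
theorem IsGibbsMeasure.exists_matchEstimates (hU : IsInteraction U)
    {μ : Measure (ℤ → 𝒜)} [IsProbabilityMeasure μ] (hμ : IsGibbsMeasure U μ) :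
    ∃ c C, MatchEstimates μ (alpha U) c C := by
  obtain ⟨C₀, hC₀, hG⟩ := hμ.exists_measure_blockWord_bounds hU
  obtain ⟨c, hc, C₁, hC₁, hcα, hW⟩ := hU.exists_wordWeight_bounds
  have hmw : ∀ (i : ℤ) (k : ℕ), Measurable (blockWord i k : (ℤ → 𝒜) → window k → 𝒜) :=
    fun i k => (measurable_blockWord (Δ := Set.univ) (by simp)).mono cylinderEvents_le_pi le_rfl
  have hsum : ∀ (i j : ℤ) (k : ℕ) (B : Set (ℤ → 𝒜)), Disjoint (block i k) (block j k) →
      MeasurableSet[cylinderEvents ((block i k ∪ block j k : Finset ℤ) : Set ℤ)ᶜ] B →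
      C₀⁻¹ ^ 2 * (∑ w, wordWeight U k w ^ 2) * μ.real B ≤ μ.real (matchSet i j k ∩ B) ∧
      μ.real (matchSet i j k ∩ B) ≤ C₀ ^ 2 * (∑ w, wordWeight U k w ^ 2) * μ.real B := by
    intro i j k B hd hB
    have hBi : MeasurableSet[cylinderEvents ((block i k : Set ℤ)ᶜ)] B :=
      cylinderEvents_mono (Set.compl_subset_compl.2 (by simp)) _ hB
    have hBj : MeasurableSet[cylinderEvents ((block j k : Set ℤ)ᶜ)] B :=
      cylinderEvents_mono (Set.compl_subset_compl.2 (by simp)) _ hB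
    have hfib : ∀ w : window k → 𝒜, {σ | blockWord i k σ = w} ∩ (matchSet i j k ∩ B)
        = {σ | blockWord i k σ = w} ∩ ({σ | blockWord j k σ = w} ∩ B) := by
      intro w
      ext σ
      simp only [Set.mem_inter_iff, Set.mem_ofPred_eq, ← blockWord_eq_blockWord_iff]
      constructor
      · rintro ⟨rfl, h, hb⟩; exact ⟨rfl, h.symm, hb⟩
      · rintro ⟨h1, h2, hb⟩; exact ⟨h1, h1.trans h2.symm, hb⟩
    have hmB : ∀ w : window k → 𝒜, MeasurableSet[cylinderEvents ((block i k : Set ℤ)ᶜ)]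
        ({σ | blockWord j k σ = w} ∩ B) := by
      intro w
      refine MeasurableSet.inter ?_ hBi
      exact measurable_blockWord (fun x hx hx' => Finset.disjoint_left.1 hd hx' hx)
        (measurableSet_singleton w)
    rw [measureReal_eq_sum_fiber μ (hmw i k)
      ((measurableSet_matchSet_pi i j k).inter (cylinderEvents_le_pi _ hBi))]
    simp only [hfib]
    rw [Finset.mul_sum, Finset.sum_mul, Finset.mul_sum, Finset.sum_mul]
    constructor <;> refine Finset.sum_le_sum fun w _ => ?_
    · calc C₀⁻¹ ^ 2 * wordWeight U k w ^ 2 * μ.real B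
          = C₀⁻¹ * wordWeight U k w * (C₀⁻¹ * wordWeight U k w * μ.real B) := by ring
        _ ≤ C₀⁻¹ * wordWeight U k w * μ.real ({σ | blockWord j k σ = w} ∩ B) := by
            have := wordWeight_pos U w
            gcongr
            exact (hG j k w B hBj).1
        _ ≤ _ := (hG i k w _ (hmB w)).1
    · calc _ ≤ C₀ * wordWeight U k w * μ.real ({σ | blockWord j k σ = w} ∩ B) :=
            (hG i k w _ (hmB w)).2
        _ ≤ C₀ * wordWeight U k w * (C₀ * wordWeight U k w * μ.real B) := by
            have := wordWeight_pos U w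
            gcongr
            exact (hG j k w B hBj).2
        _ = _ := by ring
  refine ⟨c, C₀ ^ 2 * C₁, ⟨hc, hcα, ?_, ?_, ?_, ?_⟩⟩
  · nlinarith
  · intro i j k B hd hB
    refine le_trans ?_ (hsum i j k B hd hB).1
    rw [mul_inv, ← inv_pow, mul_assoc _ C₁⁻¹]
    gcongr
    exact (hW k).1
  · intro i j k B hd hB
    refine (hsum i j k B hd hB).2.trans ?_
    rw [mul_assoc _ C₁]
    gcongr
    exact (hW k).2.1
  · intro s b r B hr hB
    have hcopy : ∀ w : window b → 𝒜,
        {σ : ℤ → 𝒜 | (fun l : window b => σ (r l)) = w} ∩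
          ({σ | ∀ l ∈ window b, σ (s + l) = σ (r l)} ∩ B)
        = {σ | blockWord s b σ = w} ∩ ({σ | (fun l : window b => σ (r l)) = w} ∩ B) := by
      intro w
      ext σ
      simp only [Set.mem_inter_iff, Set.mem_ofPred_eq]
      constructor
      · rintro ⟨h1, h2, hb⟩
        exact ⟨by rw [← h1]; exact funext fun l => h2 l l.2, h1, hb⟩
      · rintro ⟨h1, h2, hb⟩
        refine ⟨h2, fun l hl => ?_, hb⟩
        exact (congrFun h1 ⟨l, hl⟩).trans (congrFun h2 ⟨l, hl⟩).symm
    have hmr : Measurable[cylinderEvents ((block s b : Set ℤ)ᶜ)]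
        fun (σ : ℤ → 𝒜) (l : window b) => σ (r l) := by
      refine @measurable_pi_lambda _ _ _ (cylinderEvents _) _ _ fun l => ?_
      exact measurable_cylinderEvents_iff.1 (@measurable_id _ (cylinderEvents _)) (hr l l.2)
    have hBpi : MeasurableSet B := cylinderEvents_le_pi _ hB
    have hmr' := hmr.mono cylinderEvents_le_pi le_rfl
    have hmcopy : MeasurableSet {σ : ℤ → 𝒜 | ∀ l ∈ window b, σ (s + l) = σ (r l)} := by
      have : {σ : ℤ → 𝒜 | ∀ l ∈ window b, σ (s + l) = σ (r l)}
          = {σ | blockWord s b σ = fun l : window b => σ (r l)} := by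
        ext σ
        exact ⟨fun h => funext fun l => h l l.2, fun h l hl => congrFun h ⟨l, hl⟩⟩
      rw [this]
      exact measurableSet_eq_fun (hmw s b) hmr'
    rw [measureReal_eq_sum_fiber μ hmr' (hmcopy.inter hBpi), measureReal_eq_sum_fiber μ hmr' hBpi,
      Finset.mul_sum]
    refine Finset.sum_le_sum fun w _ => ?_
    rw [hcopy w]
    refine (hG s b w _ (MeasurableSet.inter (hmr (measurableSet_singleton w)) hB)).2.trans ?_
    refine mul_le_mul_of_nonneg_right ?_ measureReal_nonneg
    calc C₀ * wordWeight U b w ≤ C₀ * (C₁ * Real.exp (-((alpha U + c) * b))) := by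
          gcongr; exact (hW b).2.2 w
      _ ≤ C₀ ^ 2 * C₁ * Real.exp (-((alpha U + c) * b)) := by
          rw [← mul_assoc]
          gcongr
          nlinarith

end Gibbs

/-! ### Correlation profile and second moment inequality -/

/-- The correlation profile `exp (-c|a|/2) + exp (-αk)` of matches whose positions differ by `a`. -/
noncomputable def overlapProfile (α c : ℝ) (k : ℕ) (a : ℤ) : ℝ :=
  Real.exp (-(c / 2 * |(a : ℝ)|)) + Real.exp (-(α * k))

lemma overlapProfile_pos (α c : ℝ) (k : ℕ) (a : ℤ) : 0 < overlapProfile α c k a := by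
  unfold overlapProfile; positivity

/-- Each row sum is at most `T + q exp (-αk)`, where `T` is the sum of the exponential term over all
integer displacements. -/
lemma exists_sum_overlapProfile_le {c : ℝ} (hc : 0 < c) :
    ∃ T > 0, ∀ (α : ℝ) (k q : ℕ),
      ∑ i ∈ Finset.range q, ∑ j ∈ Finset.range q, overlapProfile α c k ((j : ℤ) - i)
        ≤ q * (T + q * Real.exp (-(α * k))) := by
  have hs : Summable fun j : ℕ => Real.exp (-(c / 2 * j)) := by
    refine (Real.summable_exp_nat_mul_iff (a := -(c / 2))).2 (by linarith) |>.congr fun j => ?_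
    ring_nf
  have hsum : Summable fun a : ℤ => Real.exp (-(c / 2 * |(a : ℝ)|)) :=
    Summable.of_nat_of_neg (by simpa using hs) (by simpa using hs)
  refine ⟨∑' a : ℤ, Real.exp (-(c / 2 * |(a : ℝ)|)),
    hsum.tsum_pos (fun _ => (Real.exp_pos _).le) 0 (Real.exp_pos _), fun α k q => ?_⟩
  rw [← nsmul_eq_mul (q : ℕ)]
  conv_rhs => rw [← Finset.card_range q]
  refine Finset.sum_le_card_nsmul _ _ _ fun i _ => ?_
  simp only [overlapProfile]
  rw [Finset.sum_add_distrib, Finset.sum_const, Finset.card_range, nsmul_eq_mul]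
  gcongr
  have hinj : Set.InjOn (fun j : ℕ => (j : ℤ) - i) (Finset.range q) := fun a _ b _ h => by
    simp only at h; lia
  rw [← Finset.sum_image (f := fun a : ℤ => Real.exp (-(c / 2 * |(a : ℝ)|))) hinj]
  exact hsum.sum_le_tsum _ fun _ _ => (Real.exp_pos _).le

/-- The second moment method for the union of finitely many events. -/
lemma sq_sum_measureReal_le {Ω ι : Type*} [MeasurableSpace Ω] (ν : Measure Ω) [IsFiniteMeasure ν]
    (s : Finset ι) {A : ι → Set Ω} (hA : ∀ p, MeasurableSet (A p)) :
    (∑ p ∈ s, ν.real (A p)) ^ 2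
      ≤ (∑ p ∈ s, ∑ q ∈ s, ν.real (A p ∩ A q)) * ν.real (⋃ p ∈ s, A p) := by
  classical
  set S₁ := ∑ p ∈ s, ν.real (A p) with hS₁
  set S₂ := ∑ p ∈ s, ∑ q ∈ s, ν.real (A p ∩ A q) with hS₂
  set V := ⋃ p ∈ s, A p with hV
  have hVm : MeasurableSet V := s.measurableSet_biUnion fun p _ => hA p
  have hI : ∀ p, Integrable ((A p).indicator fun _ => (1 : ℝ)) ν := fun p =>
    (integrable_const _).indicator (hA p)
  have hII : ∀ p q, Integrable ((A p ∩ A q).indicator fun _ => (1 : ℝ)) ν := fun p q =>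
    (integrable_const _).indicator ((hA p).inter (hA q))
  have hIV : Integrable (V.indicator fun _ => (1 : ℝ)) ν := (integrable_const _).indicator hVm
  have hint : ∀ B, MeasurableSet B → ∫ x, B.indicator (fun _ => (1 : ℝ)) x ∂ν = ν.real B :=
    fun B hB => by rw [integral_indicator hB, setIntegral_const, smul_eq_mul, mul_one]
  -- This is Cauchy–Schwarz for the counting function and the indicator of `V`: the counting
  -- function vanishes off `V`, so the integral of `(count - t 1_V)^2` is the displayed quadratic in
  -- `t`, and its discriminant is nonpositive.
  have key : ∀ t : ℝ, 0 ≤ S₂ - 2 * t * S₁ + t ^ 2 * ν.real V := by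
    intro t
    have hpt : ∀ x, (∑ p ∈ s, (A p).indicator (fun _ => (1 : ℝ)) x
        - t * V.indicator (fun _ => (1 : ℝ)) x) ^ 2
        = ∑ p ∈ s, ∑ q ∈ s, (A p ∩ A q).indicator (fun _ => (1 : ℝ)) x
          - 2 * t * ∑ p ∈ s, (A p).indicator (fun _ => (1 : ℝ)) x
          + t ^ 2 * V.indicator (fun _ => (1 : ℝ)) x := by
      intro x
      have h1 : ∑ p ∈ s, ∑ q ∈ s, (A p ∩ A q).indicator (fun _ => (1 : ℝ)) x
          = (∑ p ∈ s, (A p).indicator (fun _ => (1 : ℝ)) x) ^ 2 := by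
        rw [sq, Finset.sum_mul_sum]
        refine Finset.sum_congr rfl fun p _ => Finset.sum_congr rfl fun q _ => ?_
        by_cases hp : x ∈ A p <;> by_cases hq : x ∈ A q <;> simp [hp, hq]
      rw [h1]
      by_cases hx : x ∈ V
      · rw [Set.indicator_of_mem hx]; ring
      · have h0 : ∑ p ∈ s, (A p).indicator (fun _ => (1 : ℝ)) x = 0 := by
          refine Finset.sum_eq_zero fun p hp => Set.indicator_of_notMem (fun h => hx ?_) _
          exact Set.mem_biUnion hp h
        rw [h0, Set.indicator_of_notMem hx]; ring
    have h0 : 0 ≤ ∫ x, (∑ p ∈ s, (A p).indicator (fun _ => (1 : ℝ)) x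
        - t * V.indicator (fun _ => (1 : ℝ)) x) ^ 2 ∂ν := integral_nonneg fun _ => sq_nonneg _
    simp only [hpt] at h0
    rw [integral_add, integral_sub, integral_const_mul, integral_const_mul,
      integral_finsetSum _ fun p _ => hI p, integral_finsetSum, hint V hVm] at h0
    · simp only [hint _ (hA _)] at h0
      refine h0.trans_eq ?_
      rw [hS₁, hS₂]
      congr 2
      refine Finset.sum_congr rfl fun p _ => ?_
      rw [integral_finsetSum _ fun q _ => hII p q]
      exact Finset.sum_congr rfl fun q _ => hint _ ((hA p).inter (hA q))
    · exact fun p _ => integrable_finsetSum _ fun q _ => hII p q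
    · exact integrable_finsetSum _ fun p _ => integrable_finsetSum _ fun q _ => hII p q
    · exact (integrable_finsetSum _ fun p _ => hI p).const_mul _
    · exact (integrable_finsetSum _ fun p _ => integrable_finsetSum _ fun q _ => hII p q).sub
        ((integrable_finsetSum _ fun p _ => hI p).const_mul _)
    · exact hIV.const_mul _
  have hd := discrim_le_zero (a := ν.real V) (b := -(2 * S₁)) (c := S₂) fun t => by
    have := key t; nlinarith
  rw [discrim] at hd
  nlinarith

/-! ### First and second moments of matches -/

section Estimates

variable {𝒜 : Type*} [Finite 𝒜] [MeasurableSpace 𝒜] [MeasurableSingletonClass 𝒜]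
  {μ : Measure (ℤ → 𝒜)} [IsProbabilityMeasure μ] {α c C : ℝ}

omit [Finite 𝒜] [MeasurableSingletonClass 𝒜] in
-- Disjoint blocks produce the term `exp (-αk)` of the profile. For overlapping blocks the left one
-- is a copy of letters to its right, and `exp (-ck)` is at most `exp (-c(j-i)/2)` because `j - i <
-- k`.
lemma MatchEstimates.measureReal_matchSet_le (h : MatchEstimates μ α c C) {i j : ℤ} (hij : i < j)
    (k : ℕ) : μ.real (matchSet i j k)
      ≤ C * Real.exp (-(α * k)) * overlapProfile α c k (j - i) := by
  have hc := h.c_pos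
  have hα := h.c_le
  have hC := h.one_le
  rw [mul_assoc]
  have hexp : Real.exp (-(α * k)) * Real.exp (-(α * k)) = Real.exp (-(2 * α * k)) := by
    rw [← Real.exp_add]; congr 1; ring
  by_cases hk : i + k ≤ j
  · have hd : Disjoint (block i k) (block j k) := Finset.disjoint_left.2 fun x hx hx' => by
      rw [mem_block] at hx hx'; lia
    have := h.upper i j k Set.univ hd MeasurableSet.univ
    simp only [Set.inter_univ, probReal_univ, mul_one] at this
    refine this.trans ?_
    rw [← hexp]
    gcongr
    unfold overlapProfile
    linarith [Real.exp_pos (-(c / 2 * |((j - i : ℤ) : ℝ)|))]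
  · obtain ⟨r, hr, hsub⟩ := exists_copy_of_overlap (𝒜 := 𝒜) i (j - i) (by lia) k
    rw [add_sub_cancel] at hsub
    have := h.copy i k r Set.univ hr MeasurableSet.univ
    simp only [Set.inter_univ, probReal_univ, mul_one] at this
    refine (measureReal_mono hsub).trans (this.trans ?_)
    gcongr
    calc Real.exp (-((α + c) * k))
        ≤ Real.exp (-(α * k)) * Real.exp (-(c / 2 * |((j - i : ℤ) : ℝ)|)) := by
          rw [← Real.exp_add, Real.exp_le_exp]
          have h1 : |((j - i : ℤ) : ℝ)| ≤ k := by
            rw [← Int.cast_abs, abs_of_pos (by lia)]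
            exact_mod_cast (by lia : j - i ≤ k)
          have h2 : 0 ≤ (k : ℝ) := Nat.cast_nonneg k
          nlinarith
      _ ≤ _ := by
          gcongr
          unfold overlapProfile
          linarith [Real.exp_pos (-(α * k))]

/-- The piece `block s b` of the block at `j'` avoids the blocks at `i`, `j` and `i'`. Given the
first match, the second one still forces this piece to copy letters at `i'`, at the price `exp
(-(α+c)b)`. -/
lemma MatchEstimates.inter_le_of_block (h : MatchEstimates μ α c C) {Δ : Finset ℤ}
    {i i' j j' : ℤ} {k b : ℕ} {s : ℤ} {B : Set (ℤ → 𝒜)}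
    (hi : block i k ⊆ Δ) (hj : block j k ⊆ Δ) (hj' : block j' k ⊆ Δ)
    (hij : Disjoint (block i k) (block j k)) (hij' : Disjoint (block i k) (block j' k))
    (hi'j' : Disjoint (block i' k) (block j' k))
    (hB : MeasurableSet[cylinderEvents (Δ : Set ℤ)ᶜ] B)
    (hs : j' ≤ s) (hsb : s + b ≤ j' + k) (hsj : Disjoint (block s b) (block j k)) :
    μ.real (matchSet i j k ∩ (matchSet i' j' k ∩ B))
      ≤ C * Real.exp (-((α + c) * b)) * (C * Real.exp (-(2 * α * k)) * μ.real B) := by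
  have hC := h.one_le
  have hsub : block s b ⊆ block j' k := fun x hx => by
    rw [mem_block] at hx ⊢; lia
  have hBs : MeasurableSet[cylinderEvents (block s b : Set ℤ)ᶜ] B :=
    cylinderEvents_mono (Set.compl_subset_compl.2 (by exact_mod_cast hsub.trans hj')) _ hB
  have hEB : MeasurableSet[cylinderEvents (block s b : Set ℤ)ᶜ] (matchSet i j k ∩ B) := by
    refine MeasurableSet.inter (measurableSet_matchSet (fun x hx hx' => ?_) fun x hx hx' => ?_) hBs
    · exact Finset.disjoint_left.1 hij' hx (hsub hx')
    · exact Finset.disjoint_left.1 hsj hx' hx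
  have h1 := h.copy s b (fun l => i' + (s - j') + l) (matchSet i j k ∩ B) (fun l hl hl' => by
    have hl1 := mem_window.1 hl
    refine Finset.disjoint_left.1 hi'j' (mem_block.2 ?_) (hsub hl')
    constructor <;> lia) hEB
  have h2 := h.upper i j k B hij
    (cylinderEvents_mono (Set.compl_subset_compl.2
      (by exact_mod_cast Finset.union_subset hi hj)) _ hB)
  refine (measureReal_mono ?_).trans (h1.trans ?_)
  · rintro σ ⟨hσ, hσ', hσB⟩
    refine ⟨fun l hl => ?_, hσ, hσB⟩
    have hl1 := mem_window.1 hl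
    have := hσ' (s - j' + l) (mem_window.2 ⟨by lia, by lia⟩)
    simp only [shiftConfig] at this
    rw [show i' + (s - j') + l = i' + (s - j' + l) by ring, this]
    congr 1; ring
  · gcongr

lemma MatchEstimates.inter_le_of_le_dist (h : MatchEstimates μ α c C) {Δ : Finset ℤ}
    {i i' j j' : ℤ} {k b : ℕ} {B : Set (ℤ → 𝒜)}
    (hi : block i k ⊆ Δ) (hj : block j k ⊆ Δ) (hj' : block j' k ⊆ Δ)
    (hij : Disjoint (block i k) (block j k)) (hij' : Disjoint (block i k) (block j' k))
    (hi'j' : Disjoint (block i' k) (block j' k))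
    (hB : MeasurableSet[cylinderEvents (Δ : Set ℤ)ᶜ] B)
    (hbk : b ≤ k) (hb : (b : ℤ) ≤ |j' - j|) :
    μ.real (matchSet i j k ∩ (matchSet i' j' k ∩ B))
      ≤ C * Real.exp (-((α + c) * b)) * (C * Real.exp (-(2 * α * k)) * μ.real B) := by
  -- The piece of the block at `j'` sticking out of the block at `j` is its right end or its left
  -- end, according to the direction of the shift.
  rcases le_total j j' with hjj | hjj
  · rw [abs_of_nonneg (by lia)] at hb
    refine h.inter_le_of_block (s := j' + k - b) hi hj hj' hij hij' hi'j' hB (by lia) (by lia) ?_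
    exact Finset.disjoint_left.2 fun x hx hx' => by rw [mem_block] at hx hx'; lia
  · rw [abs_of_nonpos (by lia)] at hb
    refine h.inter_le_of_block (s := j') hi hj hj' hij hij' hi'j' hB le_rfl (by lia) ?_
    exact Finset.disjoint_left.2 fun x hx hx' => by rw [mem_block] at hx hx'; lia

/-- If both displacements are at least `k`, the four blocks are disjoint and two factors `exp
(-2αk)` arise. Otherwise the larger displacement, cut off at `k`, serves as the length of the copied
piece; its cost covers both profile factors since `c ≤ α`. -/
lemma MatchEstimates.inter_le (h : MatchEstimates μ α c C) {Δ : Finset ℤ}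
    {i i' j j' : ℤ} {k : ℕ} {B : Set (ℤ → 𝒜)}
    (hi : block i k ⊆ Δ) (hi' : block i' k ⊆ Δ) (hj : block j k ⊆ Δ) (hj' : block j' k ⊆ Δ)
    (hij : Disjoint (block i k) (block j k)) (hij' : Disjoint (block i k) (block j' k))
    (hi'j : Disjoint (block i' k) (block j k)) (hi'j' : Disjoint (block i' k) (block j' k))
    (hB : MeasurableSet[cylinderEvents (Δ : Set ℤ)ᶜ] B) :
    μ.real (matchSet i j k ∩ (matchSet i' j' k ∩ B))
      ≤ C ^ 2 * Real.exp (-(2 * α * k)) *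
        (overlapProfile α c k (i' - i) * overlapProfile α c k (j' - j)) * μ.real B := by
  have hc := h.c_pos
  have hα := h.c_le
  have hC := h.one_le
  have hk0 : (0 : ℝ) ≤ k := Nat.cast_nonneg k
  have reduce : ∀ E : ℝ,
      E ≤ overlapProfile α c k (i' - i) * overlapProfile α c k (j' - j) →
      μ.real (matchSet i j k ∩ (matchSet i' j' k ∩ B))
        ≤ C * E * (C * Real.exp (-(2 * α * k)) * μ.real B) →
      μ.real (matchSet i j k ∩ (matchSet i' j' k ∩ B))
      ≤ C ^ 2 * Real.exp (-(2 * α * k)) *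
        (overlapProfile α c k (i' - i) * overlapProfile α c k (j' - j)) * μ.real B := by
    intro E hE hle
    refine hle.trans ?_
    rw [show C * E * (C * Real.exp (-(2 * α * k)) * μ.real B)
      = C ^ 2 * Real.exp (-(2 * α * k)) * E * μ.real B by ring]
    gcongr
  have right : ∀ b : ℕ, b ≤ k → (b : ℤ) ≤ |j' - j| →
      μ.real (matchSet i j k ∩ (matchSet i' j' k ∩ B))
        ≤ C * Real.exp (-((α + c) * b)) * (C * Real.exp (-(2 * α * k)) * μ.real B) :=
    fun b => h.inter_le_of_le_dist hi hj hj' hij hij' hi'j' hB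
  have left : ∀ b : ℕ, b ≤ k → (b : ℤ) ≤ |i' - i| →
      μ.real (matchSet i j k ∩ (matchSet i' j' k ∩ B))
        ≤ C * Real.exp (-((α + c) * b)) * (C * Real.exp (-(2 * α * k)) * μ.real B) := by
    intro b h1 h2
    -- Matching is symmetric, so the left blocks may take the role of the right ones.
    rw [matchSet_comm i j, matchSet_comm i' j']
    exact h.inter_le_of_le_dist hj hi hi' hij.symm hi'j.symm hi'j'.symm hB h1 h2
  have hp1 : ∀ a : ℤ, Real.exp (-(c / 2 * |(a : ℝ)|)) ≤ overlapProfile α c k a := fun a => by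
    unfold overlapProfile; linarith [Real.exp_pos (-(α * k))]
  have hp2 : ∀ a : ℤ, Real.exp (-(α * k)) ≤ overlapProfile α c k a := fun a => by
    unfold overlapProfile; linarith [Real.exp_pos (-(c / 2 * |(a : ℝ)|))]
  have hprod : ∀ {x y u v : ℝ}, Real.exp x ≤ u → Real.exp y ≤ v → Real.exp (x + y) ≤ u * v :=
    fun {x y u v} h1 h2 => by
      rw [Real.exp_add]
      exact mul_le_mul h1 h2 (Real.exp_pos _).le ((Real.exp_pos _).le.trans h1)
  have hcast : ∀ a : ℤ, |(a : ℝ)| = (a.natAbs : ℝ) := fun a => by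
    rw [← Int.cast_abs, Int.abs_eq_natAbs, Int.cast_natCast]
  have hnat : ∀ a : ℤ, |a| = (a.natAbs : ℤ) := Int.abs_eq_natAbs
  set p := (i' - i).natAbs with hp
  set r := (j' - j).natAbs with hr
  have hpi : |((i' - i : ℤ) : ℝ)| = p := hcast _
  have hrj : |((j' - j : ℤ) : ℝ)| = r := hcast _
  have hpi' : |i' - i| = (p : ℤ) := hnat _
  have hrj' : |j' - j| = (r : ℤ) := hnat _
  have hp0 : (0 : ℝ) ≤ p := Nat.cast_nonneg p
  have hr0 : (0 : ℝ) ≤ r := Nat.cast_nonneg r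
  by_cases h1 : k ≤ p <;> by_cases h2 : k ≤ r
  · refine reduce (Real.exp (-(α * k) + -(α * k))) (hprod (hp2 _) (hp2 _)) ?_
    have hcyl : ∀ s : Finset ℤ, s ⊆ Δ →
        MeasurableSet[cylinderEvents ((s : Set ℤ)ᶜ)] B := fun s hs =>
      cylinderEvents_mono (Set.compl_subset_compl.2 (by exact_mod_cast hs)) _ hB
    have hii : Disjoint (block i k) (block i' k) := Finset.disjoint_left.2 fun x hx hx' => by
      rw [mem_block] at hx hx'; lia
    have hjj : Disjoint (block j k) (block j' k) := Finset.disjoint_left.2 fun x hx hx' => by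
      rw [mem_block] at hx hx'; lia
    have e1 := h.upper i j k (matchSet i' j' k ∩ B) hij (by
      refine MeasurableSet.inter (measurableSet_matchSet ?_ ?_)
        (hcyl _ (Finset.union_subset hi hj))
      · intro x hx hx'
        rcases Finset.mem_union.1 (Finset.mem_coe.1 hx') with hx' | hx'
        · exact Finset.disjoint_left.1 hii hx' hx
        · exact Finset.disjoint_left.1 hi'j hx hx'
      · intro x hx hx'
        rcases Finset.mem_union.1 (Finset.mem_coe.1 hx') with hx' | hx'
        · exact Finset.disjoint_left.1 hij' hx' hx
        · exact Finset.disjoint_left.1 hjj hx' hx)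
    have e2 := h.upper i' j' k B hi'j' (hcyl _ (Finset.union_subset hi' hj'))
    rw [show -(α * (k : ℝ)) + -(α * k) = -(2 * α * k) by ring]
    refine e1.trans ?_
    gcongr
  · refine reduce _ ?_ (left k le_rfl (by rw [hpi']; exact_mod_cast h1))
    refine le_trans ?_ (hprod (hp2 _) (hp1 _))
    rw [Real.exp_le_exp, hrj]
    have : (r : ℝ) ≤ k := by exact_mod_cast (not_le.1 h2).le
    nlinarith
  · refine reduce _ ?_ (right k le_rfl (by rw [hrj']; exact_mod_cast h2))
    refine le_trans ?_ (hprod (hp1 _) (hp2 _))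
    rw [Real.exp_le_exp, hpi]
    have : (p : ℝ) ≤ k := by exact_mod_cast (not_le.1 h1).le
    nlinarith
  · rcases le_total p r with hpr | hpr
    · refine reduce _ ?_ (right r (not_le.1 h2).le hrj'.ge)
      refine le_trans ?_ (hprod (hp1 _) (hp1 _))
      rw [Real.exp_le_exp, hpi, hrj]
      have : (p : ℝ) ≤ r := by exact_mod_cast hpr
      nlinarith
    · refine reduce _ ?_ (left p (not_le.1 h1).le hpi'.ge)
      refine le_trans ?_ (hprod (hp1 _) (hp1 _))
      rw [Real.exp_le_exp, hpi, hrj]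
      have : (r : ℝ) ≤ p := by exact_mod_cast hpr
      nlinarith

/-- The event that some pattern of length `k` occurs twice in the block `C_L + s`. -/
def matchWithin (s : ℤ) (L k : ℕ) : Set (ℤ → 𝒜) :=
  {σ | ∃ i j : ℤ, s ≤ i ∧ i < j ∧ j + k ≤ s + L ∧ σ ∈ matchSet i j k}

lemma measurableSet_matchWithin (s : ℤ) (L k : ℕ) :
    MeasurableSet[cylinderEvents (block s L : Set ℤ)] (matchWithin s L k : Set (ℤ → 𝒜)) := by
  have : (matchWithin s L k : Set (ℤ → 𝒜))
      = ⋃ i : ℤ, ⋃ j : ℤ, ⋃ _ : s ≤ i ∧ i < j ∧ j + k ≤ s + L, matchSet i j k := by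
    ext σ
    simp only [matchWithin, Set.mem_ofPred_eq, Set.mem_iUnion, exists_prop, and_assoc]
  rw [this]
  refine MeasurableSet.iUnion fun i => MeasurableSet.iUnion fun j => MeasurableSet.iUnion fun hij =>
    measurableSet_matchSet (fun x hx => ?_) fun x hx => ?_ <;>
  · rw [mem_block] at hx
    exact Finset.mem_coe.2 (mem_block.2 ⟨by lia, by lia⟩)

/-- Conditionally on the configuration outside, a block of length of order `exp (αk)` contains a
match of length `k` with probability bounded away from zero. -/
theorem MatchEstimates.exists_le_matchWithin (h : MatchEstimates μ α c C) {K : ℝ} (hK : 0 < K) :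
    ∃ δ > 0, ∀ (s : ℤ) (q k L : ℕ) (B : Set (ℤ → 𝒜)), K * Real.exp (α * k) ≤ q →
      2 * (q + k) ≤ L → MeasurableSet[cylinderEvents (block s L : Set ℤ)ᶜ] B →
      δ * μ.real B ≤ μ.real (matchWithin s L k ∩ B) := by
  obtain ⟨T, hT, hsum⟩ := exists_sum_overlapProfile_le h.c_pos
  have hC := h.one_le
  have hC0 : 0 < C := by linarith
  -- With `x = q exp (-αk)`, the moments are at least `C⁻¹ x^2 μ(B)` and at most `C^2 x^2 (T + x)^2
  -- μ(B)`; the square of the first over the second is `C⁻¹ ^ 4 (x / (T + x))^2 μ(B)`, which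
  -- increases with `x ≥ K`.
  refine ⟨C⁻¹ ^ 4 * (K / (T + K)) ^ 2, by positivity, fun s q k L B hq hL hB => ?_⟩
  rcases (measureReal_nonneg (μ := μ) (s := B)).eq_or_lt with hB0 | hB0
  · rw [← hB0, mul_zero]; exact measureReal_nonneg
  have hBpi : MeasurableSet B := cylinderEvents_le_pi _ hB
  have hq0 : 0 < (q : ℝ) := lt_of_lt_of_le (by positivity) hq
  set e := Real.exp (-(α * k)) with he
  have he0 : 0 < e := Real.exp_pos _
  have he2 : Real.exp (-(2 * α * k)) = e ^ 2 := by
    rw [he, ← Real.exp_nat_mul]; congr 1; push_cast; ring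
  have hx : K ≤ q * e := by
    have : Real.exp (α * k) * e = 1 := by rw [he, ← Real.exp_add]; simp
    calc K = K * Real.exp (α * k) * e := by rw [mul_assoc, this, mul_one]
      _ ≤ q * e := by gcongr
  let P : Finset (ℕ × ℕ) := Finset.range q ×ˢ Finset.range q
  -- Only pairs with one position in each half are used: the gap makes every left block disjoint
  -- from every right block, even across different pairs, as `inter_le` requires.
  let A : ℕ × ℕ → Set (ℤ → 𝒜) := fun p => matchSet (s + p.1) (s + q + k + p.2) k
  have hblk1 : ∀ p ∈ P, block (s + p.1) k ⊆ block s L := fun p hp x hx => by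
    have := (Finset.mem_product.1 hp).1; rw [Finset.mem_range] at this
    rw [mem_block] at hx ⊢; lia
  have hblk2 : ∀ p ∈ P, block (s + q + k + p.2) k ⊆ block s L := fun p hp x hx => by
    have := (Finset.mem_product.1 hp).2; rw [Finset.mem_range] at this
    rw [mem_block] at hx ⊢; lia
  have hdisj : ∀ p ∈ P, ∀ p' ∈ P, Disjoint (block (s + p.1) k) (block (s + q + k + p'.2) k) :=
    fun p hp p' _ => Finset.disjoint_left.2 fun x hx hx' => by
      have := (Finset.mem_product.1 hp).1; rw [Finset.mem_range] at this
      rw [mem_block] at hx hx'; lia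
  have hAm : ∀ p, MeasurableSet (A p) := fun p => measurableSet_matchSet_pi _ _ _
  set ν := μ.restrict B with hν
  have hνreal : ∀ E, MeasurableSet E → ν.real E = μ.real (E ∩ B) := fun E hE =>
    measureReal_restrict_apply hE
  have first : C⁻¹ * q ^ 2 * e ^ 2 * μ.real B ≤ ∑ p ∈ P, ν.real (A p) := by
    have : ∀ p ∈ P, C⁻¹ * e ^ 2 * μ.real B ≤ ν.real (A p) := fun p hp => by
      rw [hνreal _ (hAm p), ← he2]
      exact h.lower _ _ k B (hdisj p hp p hp) (cylinderEvents_mono (Set.compl_subset_compl.2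
        (by exact_mod_cast Finset.union_subset (hblk1 p hp) (hblk2 p hp))) _ hB)
    have := Finset.card_nsmul_le_sum P _ _ this
    rw [Finset.card_product, Finset.card_range, nsmul_eq_mul] at this
    push_cast at this
    linarith
  have second : ∑ p ∈ P, ∑ p' ∈ P, ν.real (A p ∩ A p')
      ≤ C ^ 2 * e ^ 2 * (q * (T + q * e)) ^ 2 * μ.real B := by
    calc ∑ p ∈ P, ∑ p' ∈ P, ν.real (A p ∩ A p')
        ≤ ∑ p ∈ P, ∑ p' ∈ P, C ^ 2 * e ^ 2 *
          (overlapProfile α c k ((p'.1 : ℤ) - p.1) * overlapProfile α c k ((p'.2 : ℤ) - p.2))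
            * μ.real B := by
          refine Finset.sum_le_sum fun p hp => Finset.sum_le_sum fun p' hp' => ?_
          rw [hνreal _ ((hAm p).inter (hAm p')), Set.inter_assoc, ← he2]
          refine (h.inter_le (hblk1 p hp) (hblk1 p' hp') (hblk2 p hp) (hblk2 p' hp')
            (hdisj p hp p hp) (hdisj p hp p' hp') (hdisj p' hp' p hp) (hdisj p' hp' p' hp')
            hB).trans_eq ?_
          rw [add_sub_add_left_eq_sub, add_sub_add_left_eq_sub]
      _ = C ^ 2 * e ^ 2 * (∑ i ∈ Finset.range q, ∑ j ∈ Finset.range q,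
            overlapProfile α c k ((j : ℤ) - i)) ^ 2 * μ.real B := by
          simp only [P, Finset.sum_product, ← Finset.sum_mul, ← Finset.mul_sum]
          rw [sq (∑ i ∈ Finset.range q, _), Finset.sum_mul_sum]
      _ ≤ _ := by
          have h0 : 0 ≤ ∑ i ∈ Finset.range q, ∑ j ∈ Finset.range q,
              overlapProfile α c k ((j : ℤ) - i) :=
            Finset.sum_nonneg fun i _ => Finset.sum_nonneg fun j _ => (overlapProfile_pos _ _ _ _).le
          gcongr
          exact hsum α k q
  have hsecond := sq_sum_measureReal_le ν P hAm
  have hunion : ν.real (⋃ p ∈ P, A p) ≤ μ.real (matchWithin s L k ∩ B) := by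
    rw [hνreal _ (P.measurableSet_biUnion fun p _ => hAm p)]
    refine measureReal_mono (Set.inter_subset_inter_left _ (Set.iUnion₂_subset fun p hp σ hσ => ?_))
    have h1 := Finset.mem_product.1 hp
    rw [Finset.mem_range, Finset.mem_range] at h1
    exact ⟨s + p.1, s + q + k + p.2, by lia, by lia, by lia, hσ⟩
  set m := μ.real B
  set M := μ.real (matchWithin s L k ∩ B)
  have hM0 : 0 ≤ M := measureReal_nonneg
  have hmain : (C⁻¹ * q ^ 2 * e ^ 2 * m) ^ 2 ≤ C ^ 2 * e ^ 2 * (q * (T + q * e)) ^ 2 * m * M := by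
    calc (C⁻¹ * q ^ 2 * e ^ 2 * m) ^ 2 ≤ (∑ p ∈ P, ν.real (A p)) ^ 2 := by gcongr
      _ ≤ _ := hsecond
      _ ≤ _ := by gcongr
  have hfrac : K / (T + K) ≤ q * e / (T + q * e) := by
    rw [div_le_div_iff₀ (by positivity) (by positivity)]
    nlinarith
  calc C⁻¹ ^ 4 * (K / (T + K)) ^ 2 * m ≤ C⁻¹ ^ 4 * (q * e / (T + q * e)) ^ 2 * m := by gcongr
    _ = (C⁻¹ * q ^ 2 * e ^ 2 * m) ^ 2 / (C ^ 2 * e ^ 2 * (q * (T + q * e)) ^ 2 * m) := by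
        field_simp
    _ ≤ M := by
        rw [div_le_iff₀ (by positivity), mul_comm M]
        exact hmain

end Estimates

/-! ### From match events to the number of matches -/

section Counting

variable {𝒜 : Type*} [DecidableEq 𝒜]

lemma matchCount_eq_sum (σ : ℤ → 𝒜) (n k : ℕ) :
    matchCount σ n k = ∑ p ∈ Finset.range (n + 1 - k) ×ˢ Finset.range (n + 1 - k),
      ({σ : ℤ → 𝒜 | p.1 < p.2 ∧ σ ∈ matchSet (p.1 : ℤ) p.2 k}).indicator (fun _ => 1) σ := by
  classical
  rw [matchCount, Finset.card_filter]
  refine Finset.sum_congr rfl fun p _ => ?_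
  simp only [Set.indicator_apply, Set.mem_ofPred_eq, matchSet]

/-- Matches within disjoint blocks of `C_n` are counted separately. -/
lemma le_matchCount_of_forall_matchWithin {σ : ℤ → 𝒜} {n k M L : ℕ} {s : ℕ → ℕ}
    {L' : ℕ} (hL' : L' * M ≤ n) (hs : ∀ t < M, t * L' ≤ s t ∧ s t + L ≤ (t + 1) * L')
    (h : ∀ t < M, σ ∈ matchWithin (s t) L k) : M ≤ matchCount σ n k := by
  choose! i j h1 h2 h3 h4 using h
  have hi : ∀ t < M, ((i t).toNat : ℤ) = i t := fun t ht =>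
    Int.toNat_of_nonneg ((Int.natCast_nonneg _).trans (h1 t ht))
  have hj : ∀ t < M, ((j t).toNat : ℤ) = j t := fun t ht =>
    Int.toNat_of_nonneg ((Int.natCast_nonneg _).trans ((h1 t ht).trans (h2 t ht).le))
  have hlo : ∀ t < M, t * L' ≤ (i t).toNat := fun t ht => by
    have := (hs t ht).1
    have := h1 t ht
    have := hi t ht
    lia
  have hup : ∀ t < M, (j t).toNat + k ≤ (t + 1) * L' := fun t ht => by
    have := (hs t ht).2
    have := h3 t ht
    have := hj t ht
    lia
  have hlt : ∀ t < M, (i t).toNat < (j t).toNat := fun t ht => by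
    have := h2 t ht
    have := hi t ht
    have := hj t ht
    lia
  have hinj : Set.InjOn (fun t => ((i t).toNat, (j t).toNat)) (Finset.range M) := by
    intro a ha b hb hab
    have ha' : a < M := Finset.mem_range.1 (Finset.mem_coe.1 ha)
    have hb' : b < M := Finset.mem_range.1 (Finset.mem_coe.1 hb)
    simp only [Prod.mk.injEq] at hab
    have e1 := hlo a ha'
    have e2 := hlo b hb'
    have e3 := hup a ha'
    have e4 := hup b hb'
    have e5 := hlt a ha'
    have e6 := hlt b hb'
    have f1 : a * L' < (b + 1) * L' := by lia
    have f2 : b * L' < (a + 1) * L' := by lia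
    have := lt_of_mul_lt_mul_right f1 (Nat.zero_le _)
    have := lt_of_mul_lt_mul_right f2 (Nat.zero_le _)
    lia
  conv_lhs => rw [← Finset.card_range M]
  refine Finset.card_le_card_of_injOn _ (fun t ht => ?_) hinj
  have ht' : t < M := Finset.mem_range.1 (Finset.mem_coe.1 ht)
  have e1 := hup t ht'
  have e2 := hlt t ht'
  have e3 : (t + 1) * L' ≤ M * L' := Nat.mul_le_mul_right _ ht'
  have e4 : L' * M = M * L' := mul_comm _ _
  simp only [Finset.coe_filter, Finset.mem_product, Finset.mem_range, Set.mem_ofPred_eq]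
  refine ⟨⟨by lia, by lia⟩, e2, ?_⟩
  rw [hi t ht', hj t ht']
  exact h4 t ht'

variable [Finite 𝒜] [MeasurableSpace 𝒜] [MeasurableSingletonClass 𝒜]

lemma measurable_matchCount (n k : ℕ) :
    Measurable fun σ : ℤ → 𝒜 => matchCount σ n k := by
  simp only [matchCount_eq_sum]
  refine Finset.measurable_sum _ fun p _ => measurable_const.indicator ?_
  exact (MeasurableSet.const _).inter (measurableSet_matchSet_pi _ _ _)

variable {μ : Measure (ℤ → 𝒜)} [IsProbabilityMeasure μ] {α c C : ℝ}

/-- Markov's inequality for the number of matches. -/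
lemma MatchEstimates.exists_mul_measureReal_le (h : MatchEstimates μ α c C) :
    ∃ T > 0, ∀ n k m : ℕ, (m : ℝ) * μ.real {σ | m ≤ matchCount σ n k}
      ≤ C * ((n + 1) * Real.exp (-(α * k))) * (T + (n + 1) * Real.exp (-(α * k))) := by
  obtain ⟨T, hT, hsum⟩ := exists_sum_overlapProfile_le h.c_pos
  have hC := h.one_le
  refine ⟨T, hT, fun n k m => ?_⟩
  set e := Real.exp (-(α * k)) with he
  set q := n + 1 - k with hq
  have hqn : (q : ℝ) ≤ n + 1 := by
    exact_mod_cast (by lia : q ≤ n + 1)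
  have hmeas : ∀ p : ℕ × ℕ,
      MeasurableSet {σ : ℤ → 𝒜 | p.1 < p.2 ∧ σ ∈ matchSet (p.1 : ℤ) p.2 k} := fun p =>
    (MeasurableSet.const _).inter (measurableSet_matchSet_pi _ _ _)
  have hcast : ∀ σ : ℤ → 𝒜, (matchCount σ n k : ℝ) = ∑ p ∈ Finset.range q ×ˢ Finset.range q,
      ({σ : ℤ → 𝒜 | p.1 < p.2 ∧ σ ∈ matchSet (p.1 : ℤ) p.2 k}).indicator
        (fun _ => (1 : ℝ)) σ := by
    intro σ
    rw [matchCount_eq_sum, Nat.cast_sum]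
    refine Finset.sum_congr rfl fun p _ => ?_
    by_cases hp : σ ∈ {σ : ℤ → 𝒜 | p.1 < p.2 ∧ σ ∈ matchSet (p.1 : ℤ) p.2 k} <;> simp [hp]
  have hind : ∀ p : ℕ × ℕ, Integrable (({σ : ℤ → 𝒜 | p.1 < p.2 ∧
      σ ∈ matchSet (p.1 : ℤ) p.2 k}).indicator (fun _ => (1 : ℝ))) μ := fun p =>
    (integrable_const _).indicator (hmeas p)
  have hint : Integrable (fun σ : ℤ → 𝒜 => (matchCount σ n k : ℝ)) μ := by
    simp only [hcast]
    exact integrable_finsetSum _ fun p _ => hind p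
  have hmarkov := mul_meas_ge_le_integral_of_nonneg (μ := μ)
    (f := fun σ : ℤ → 𝒜 => (matchCount σ n k : ℝ))
    (Eventually.of_forall fun _ => Nat.cast_nonneg _) hint m
  simp only [Nat.cast_le] at hmarkov
  refine hmarkov.trans ?_
  calc ∫ σ, (matchCount σ n k : ℝ) ∂μ
      = ∑ p ∈ Finset.range q ×ˢ Finset.range q,
          μ.real {σ : ℤ → 𝒜 | p.1 < p.2 ∧ σ ∈ matchSet (p.1 : ℤ) p.2 k} := by
        simp only [hcast]
        rw [integral_finsetSum _ fun p _ => hind p]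
        refine Finset.sum_congr rfl fun p _ => ?_
        rw [integral_indicator (hmeas p), setIntegral_const, smul_eq_mul, mul_one]
    -- Pairs that are not increasing contribute nothing; keeping them only enlarges the bound and
    -- allows summing over the full square.
    _ ≤ ∑ p ∈ Finset.range q ×ˢ Finset.range q, C * e * overlapProfile α c k (p.2 - p.1) := by
        refine Finset.sum_le_sum fun p _ => ?_
        by_cases hp : p.1 < p.2
        · refine (measureReal_mono fun σ hσ => hσ.2).trans
            (h.measureReal_matchSet_le (by exact_mod_cast hp) k)
        · simp only [hp, false_and]
          have := overlapProfile_pos α c k (p.2 - p.1)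
          rw [Set.ofPred_false, measureReal_empty]
          positivity
    _ = C * e * ∑ i ∈ Finset.range q, ∑ j ∈ Finset.range q, overlapProfile α c k (j - i) := by
        rw [← Finset.mul_sum, Finset.sum_product]
    _ ≤ C * e * (q * (T + q * e)) := by
        gcongr
        exact hsum α k q
    _ ≤ C * e * ((n + 1) * (T + (n + 1) * e)) := by gcongr
    _ = _ := by ring

omit [DecidableEq 𝒜] in
/-- Consecutive blocks are simultaneously free of matches with exponentially small probability. -/
lemma measureReal_iInter_compl_matchWithin_le {δ : ℝ} (hδ : δ ≤ 1) {L k : ℕ}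
    (hmatch : ∀ (s : ℤ) (B : Set (ℤ → 𝒜)), MeasurableSet[cylinderEvents (block s L : Set ℤ)ᶜ] B →
      δ * μ.real B ≤ μ.real (matchWithin s L k ∩ B)) (s r : ℕ) :
    μ.real {σ | ∀ u < r, σ ∉ matchWithin ((s + u * L : ℕ) : ℤ) L k} ≤ (1 - δ) ^ r := by
  induction r with
  | zero => simp
  | succ r ih =>
    set Q : Set (ℤ → 𝒜) := {σ | ∀ u < r, σ ∉ matchWithin ((s + u * L : ℕ) : ℤ) L k} with hQ
    set E : Set (ℤ → 𝒜) := matchWithin ((s + r * L : ℕ) : ℤ) L k with hE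
    have hset : {σ : ℤ → 𝒜 | ∀ u < r + 1, σ ∉ matchWithin ((s + u * L : ℕ) : ℤ) L k} = Q \ E := by
      ext σ
      simp only [Nat.lt_succ_iff_lt_or_eq, Set.mem_ofPred_eq, Set.mem_sdiff, hQ, hE]
      constructor
      · exact fun h => ⟨fun u hu => h u (Or.inl hu), h r (Or.inr rfl)⟩
      · rintro ⟨h1, h2⟩ u (hu | rfl)
        · exact h1 u hu
        · exact h2
    have hEm : MeasurableSet E := cylinderEvents_le_pi _ (measurableSet_matchWithin _ _ _)
    -- Absence of matches in the earlier blocks is an event off block `r`, so the conditional lower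
    -- bound applies with it as `B`; this replaces independence.
    have hQm : MeasurableSet[cylinderEvents (block ((s + r * L : ℕ) : ℤ) L : Set ℤ)ᶜ] Q := by
      have : Q = ⋂ u : ℕ, ⋂ _ : u < r, (matchWithin ((s + u * L : ℕ) : ℤ) L k)ᶜ := by
        ext σ; simp [hQ]
      rw [this]
      refine MeasurableSet.iInter fun u => MeasurableSet.iInter fun hu => MeasurableSet.compl ?_
      refine cylinderEvents_mono ?_ _ (measurableSet_matchWithin _ _ _)
      intro x hx hx'
      rw [Finset.mem_coe, mem_block] at hx hx'
      have : (u + 1) * L ≤ r * L := Nat.mul_le_mul_right _ hu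
      have e : (u + 1) * L = u * L + L := by ring
      lia
    have h1 := hmatch _ Q hQm
    have h2 := measureReal_inter_add_sdiff (μ := μ) (s := Q) hEm
    rw [hset]
    rw [Set.inter_comm] at h1
    have h3 : (0 : ℝ) ≤ 1 - δ := by linarith
    calc μ.real (Q \ E) ≤ (1 - δ) * μ.real Q := by linarith
      _ ≤ (1 - δ) * (1 - δ) ^ r := by gcongr
      _ = _ := by ring

end Counting

/-! ### The three regimes -/

section Asymptotics

variable {𝒜 : Type*} [DecidableEq 𝒜] [Finite 𝒜] [MeasurableSpace 𝒜] [MeasurableSingletonClass 𝒜]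
  {μ : Measure (ℤ → 𝒜)} [IsProbabilityMeasure μ] {α c C : ℝ} {k : ℕ → ℕ}

omit [DecidableEq 𝒜] [Finite 𝒜] [MeasurableSingletonClass 𝒜] [IsProbabilityMeasure μ] in
lemma MatchEstimates.alpha_pos (h : MatchEstimates μ α c C) : 0 < α := h.c_pos.trans_le h.c_le

lemma natCast_mul_exp_neg {α : ℝ} (hα : 0 < α) {n : ℕ} (hn : 0 < n) (k : ℕ) :
    (n : ℝ) * Real.exp (-(α * k)) = Real.exp (-(α * ((k : ℝ) - Real.log n / α))) := by
  have hn' : (0 : ℝ) < n := by exact_mod_cast hn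
  conv_lhs => rw [← Real.exp_log hn', ← Real.exp_add]
  congr 1
  field_simp
  ring

/-- Below the critical scale the number of matches exceeds every bound. -/
lemma MatchEstimates.tendsto_measureReal_le_zero (h : MatchEstimates μ α c C)
    (hk : Tendsto (fun n : ℕ => Real.log n / α - (k n : ℝ)) atTop atTop) (m : ℕ) :
    Tendsto (fun n : ℕ => μ.real {σ | matchCount σ n (k n) ≤ m}) atTop (𝓝 0) := by
  have hα := h.alpha_pos
  obtain ⟨δ₀, hδ₀, hmatch₀⟩ := h.exists_le_matchWithin one_pos
  set δ := min δ₀ 1 with hδdef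
  have hδ : 0 < δ := lt_min hδ₀ one_pos
  have hδ1 : δ ≤ 1 := min_le_right _ _
  rw [Metric.tendsto_atTop']
  intro ε hε
  -- `C_n` is cut into `m + 1` groups of `r` blocks each. With at most `m` matches, some group has
  -- no match within any of its blocks, which has probability at most `(m + 1) (1 - δ)^r`.
  obtain ⟨r, hr, hrε⟩ : ∃ r : ℕ, 0 < r ∧ ((m : ℝ) + 1) * (1 - δ) ^ r < ε := by
    have ht : Tendsto (fun r : ℕ => ((m : ℝ) + 1) * (1 - δ) ^ r) atTop (𝓝 (((m : ℝ) + 1) * 0)) :=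
      (tendsto_pow_atTop_nhds_zero_of_lt_one (by linarith) (by linarith)).const_mul _
    rw [mul_zero] at ht
    obtain ⟨r, h1, h2⟩ := ((ht.eventually_lt_const hε).and (eventually_gt_atTop 0)).exists
    exact ⟨r, h2, h1⟩
  set R := (m + 1) * r with hR
  have hR0 : 0 < R := by positivity
  have hR' : (0 : ℝ) < R := by exact_mod_cast hR0
  have htend : Tendsto (fun n : ℕ => Real.exp (-(α * (Real.log n / α - (k n : ℝ)))))
      atTop (𝓝 0) := Real.tendsto_exp_neg_atTop_nhds_zero.comp (hk.const_mul_atTop hα)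
  -- The factor `3 + 1/α` comes from `k ≤ exp (αk) / α` and `2 ≤ 2 exp (αk)`; the summand 2 absorbs
  -- the roundings in `n / R` and `L / 2`.
  have hsmall : 0 < 1 / (2 * R * (3 + 1 / α)) := by positivity
  have hev : ∀ᶠ n : ℕ in atTop, 2 * (R : ℝ) * (Real.exp (α * k n) + k n + 2) ≤ n := by
    filter_upwards [htend.eventually_lt_const hsmall, eventually_gt_atTop 0] with n hn hn0
    have hn' : (0 : ℝ) < n := by exact_mod_cast hn0
    have h1 : Real.exp (-(α * (Real.log n / α - (k n : ℝ)))) = Real.exp (α * k n) / n := by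
      rw [show -(α * (Real.log n / α - (k n : ℝ))) = α * k n - Real.log n by field_simp; ring,
        Real.exp_sub, Real.exp_log hn']
    rw [h1, div_lt_div_iff₀ hn' (by positivity)] at hn
    have h2 : (1 : ℝ) ≤ Real.exp (α * k n) := Real.one_le_exp (by positivity)
    have h3 : (k n : ℝ) ≤ 1 / α * Real.exp (α * k n) := by
      rw [one_div, ← div_eq_inv_mul, le_div_iff₀ hα]
      linarith [Real.add_one_le_exp (α * k n)]
    calc 2 * (R : ℝ) * (Real.exp (α * k n) + k n + 2)
        ≤ 2 * R * (Real.exp (α * k n) + 1 / α * Real.exp (α * k n) + 2 * Real.exp (α * k n)) := by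
          gcongr; linarith
      _ = Real.exp (α * k n) * (2 * R * (3 + 1 / α)) := by ring
      _ ≤ n := by linarith
  obtain ⟨n₀, hn₀⟩ := eventually_atTop.1 hev
  refine ⟨n₀, fun n hn => ?_⟩
  have hbig := hn₀ n hn.le
  set L := n / R with hL
  have hLn : R * L ≤ n := Nat.mul_div_le n R
  have hhalf : Real.exp (α * k n) + k n ≤ (L / 2 : ℕ) := by
    have h1 : n < R * (2 * (L / 2) + 2) := by
      have h2 : n < R * (L + 1) := by
        have := Nat.lt_div_mul_add (a := n) hR0
        rw [mul_add, mul_one, mul_comm]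
        exact this
      exact h2.trans_le (Nat.mul_le_mul_left _ (by lia))
    have h1' : (n : ℝ) < R * (2 * ((L / 2 : ℕ) : ℝ) + 2) := by exact_mod_cast h1
    have h3 : (R : ℝ) * (2 * (Real.exp (α * k n) + k n + 2))
        < R * (2 * ((L / 2 : ℕ) : ℝ) + 2) := by linarith
    have := lt_of_mul_lt_mul_left h3 hR'.le
    linarith
  have hkL : k n ≤ L / 2 := by
    have : (k n : ℝ) ≤ ((L / 2 : ℕ) : ℝ) := by linarith [Real.exp_pos (α * k n)]
    exact_mod_cast this
  have hmatch : ∀ (s : ℤ) (B : Set (ℤ → 𝒜)),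
      MeasurableSet[cylinderEvents (block s L : Set ℤ)ᶜ] B →
      δ * μ.real B ≤ μ.real (matchWithin s L (k n) ∩ B) := fun s B hB => by
    refine le_trans ?_ (hmatch₀ s (L / 2 - k n) (k n) L B ?_ (by lia) hB)
    · gcongr
      exact min_le_left _ _
    · rw [Nat.cast_sub hkL]; linarith
  have hsub : {σ : ℤ → 𝒜 | matchCount σ n (k n) ≤ m} ⊆ ⋃ t ∈ Finset.range (m + 1),
      {σ | ∀ u < r, σ ∉ matchWithin ((t * (r * L) + u * L : ℕ) : ℤ) L (k n)} := by
    intro σ hσ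
    by_contra hcon
    simp only [Set.mem_iUnion, Finset.mem_range, Set.mem_ofPred_eq, exists_prop, not_exists,
      not_and, not_forall, not_not] at hcon
    choose! u hu hu' using hcon
    have := le_matchCount_of_forall_matchWithin (σ := σ) (n := n) (k := k n) (M := m + 1) (L := L)
      (s := fun t => t * (r * L) + u t * L) (L' := r * L)
      (by
        refine le_trans (le_of_eq ?_) hLn
        rw [hR]; ring)
      (fun t ht => ⟨Nat.le_add_right _ _, by
        have h1 : (u t + 1) * L ≤ r * L := Nat.mul_le_mul_right _ (hu t ht)
        have h2 : (u t + 1) * L = u t * L + L := by ring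
        have h3 : (t + 1) * (r * L) = t * (r * L) + r * L := by ring
        lia⟩)
      (fun t ht => hu' t ht)
    have hσ' : matchCount σ n (k n) ≤ m := hσ
    lia
  rw [Real.dist_eq, sub_zero, abs_of_nonneg measureReal_nonneg]
  calc μ.real {σ | matchCount σ n (k n) ≤ m}
      ≤ μ.real (⋃ t ∈ Finset.range (m + 1),
        {σ | ∀ u < r, σ ∉ matchWithin ((t * (r * L) + u * L : ℕ) : ℤ) L (k n)}) :=
        measureReal_mono hsub (measure_ne_top _ _)
    _ ≤ ∑ t ∈ Finset.range (m + 1),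
        μ.real {σ | ∀ u < r, σ ∉ matchWithin ((t * (r * L) + u * L : ℕ) : ℤ) L (k n)} :=
        measureReal_biUnion_finset_le _ _
    _ ≤ ∑ t ∈ Finset.range (m + 1), (1 - δ) ^ r := Finset.sum_le_sum fun t _ =>
        measureReal_iInter_compl_matchWithin_le hδ1 hmatch _ r
    _ = (m + 1) * (1 - δ) ^ r := by simp
    _ < ε := hrε

/-- Above the critical scale there are no matches. -/
lemma MatchEstimates.tendsto_measureReal_ge_zero (h : MatchEstimates μ α c C)
    (hk : Tendsto (fun n : ℕ => (k n : ℝ) - Real.log n / α) atTop atTop) {m : ℕ} (hm : 0 < m) :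
    Tendsto (fun n : ℕ => μ.real {σ | m ≤ matchCount σ n (k n)}) atTop (𝓝 0) := by
  have hα := h.alpha_pos
  have hC := h.one_le
  obtain ⟨T, hT, hmarkov⟩ := h.exists_mul_measureReal_le
  have htend : Tendsto (fun n : ℕ => 2 * Real.exp (-(α * ((k n : ℝ) - Real.log n / α))))
      atTop (𝓝 0) := by
    simpa using (Real.tendsto_exp_neg_atTop_nhds_zero.comp (hk.const_mul_atTop hα)).const_mul 2
  have hbound : Tendsto (fun n : ℕ => C * (2 * Real.exp (-(α * ((k n : ℝ) - Real.log n / α))))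
      * (T + 2 * Real.exp (-(α * ((k n : ℝ) - Real.log n / α))))) atTop (𝓝 0) := by
    simpa using (htend.const_mul C).mul (htend.const_add T)
  refine squeeze_zero' (Eventually.of_forall fun _ => measureReal_nonneg) ?_ hbound
  filter_upwards [eventually_gt_atTop 0] with n hn
  rw [← natCast_mul_exp_neg hα hn]
  have hn1 : (1 : ℝ) ≤ n := by exact_mod_cast hn
  have hx : ((n : ℝ) + 1) * Real.exp (-(α * k n)) ≤ 2 * (n * Real.exp (-(α * k n))) := by
    nlinarith [Real.exp_pos (-(α * k n))]
  have hm1 : (1 : ℝ) ≤ m := by exact_mod_cast hm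
  calc μ.real {σ | m ≤ matchCount σ n (k n)}
      ≤ m * μ.real {σ | m ≤ matchCount σ n (k n)} := le_mul_of_one_le_left measureReal_nonneg hm1
    _ ≤ _ := hmarkov n (k n) m
    _ ≤ _ := by gcongr

/-- At the critical scale the tails of the number of matches are uniformly `O(1/m)`. -/
lemma MatchEstimates.exists_measureReal_le_div (h : MatchEstimates μ α c C) {B : ℝ}
    (hk : ∀ n : ℕ, |(k n : ℝ) - Real.log n / α| ≤ B) :
    ∃ D > 0, ∀ n m : ℕ, 0 < m → μ.real {σ | m ≤ matchCount σ n (k n)} ≤ D / m := by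
  have hα := h.alpha_pos
  have hC := h.one_le
  have hB : 0 ≤ B := (abs_nonneg _).trans (hk 0)
  obtain ⟨T, hT, hmarkov⟩ := h.exists_mul_measureReal_le
  set X := 2 * Real.exp (α * B) with hX
  refine ⟨C * X * (T + X), by positivity, fun n m hm => ?_⟩
  have hx : ((n : ℝ) + 1) * Real.exp (-(α * k n)) ≤ X := by
    -- The case `n = 0` is separate because `n = exp (log n)` fails there.
    rcases Nat.eq_zero_or_pos n with rfl | hn
    · have h1 : Real.exp (-(α * k 0)) ≤ 1 := Real.exp_le_one_iff.2 (by
        have : 0 ≤ α * k 0 := by positivity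
        linarith)
      have h2 : 1 ≤ Real.exp (α * B) := Real.one_le_exp (by positivity)
      simp only [Nat.cast_zero, zero_add, one_mul]
      linarith
    · have hn1 : (1 : ℝ) ≤ n := by exact_mod_cast hn
      calc ((n : ℝ) + 1) * Real.exp (-(α * k n)) ≤ 2 * (n * Real.exp (-(α * k n))) := by
            nlinarith [Real.exp_pos (-(α * k n))]
        _ ≤ X := by
            rw [natCast_mul_exp_neg hα hn, hX]
            gcongr
            nlinarith [(abs_le.1 (hk n)).1]
  rw [le_div_iff₀ (by exact_mod_cast hm), mul_comm]
  refine (hmarkov n (k n) m).trans ?_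
  gcongr

/-- At the critical scale matches occur with probability bounded away from zero. -/
lemma MatchEstimates.exists_eventually_le_measureReal (h : MatchEstimates μ α c C) {B : ℝ}
    (hk : ∀ n : ℕ, |(k n : ℝ) - Real.log n / α| ≤ B) :
    ∃ δ > 0, ∀ᶠ n : ℕ in atTop, δ ≤ μ.real {σ | 0 < matchCount σ n (k n)} := by
  have hα := h.alpha_pos
  -- Here `exp (αk) ≤ exp (αB) n`, and `q = n / 2 - k` is at least a quarter of `n` eventually,
  -- since `k` is only logarithmic.
  obtain ⟨δ, hδ, hmatch⟩ := h.exists_le_matchWithin (K := Real.exp (-(α * B)) / 4) (by positivity)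
  refine ⟨δ, hδ, ?_⟩
  have hlog : ∀ᶠ n : ℕ in atTop, Real.log n ≤ α / 8 * n := by
    have := (Real.isLittleO_log_id_atTop.comp_tendsto tendsto_natCast_atTop_atTop).bound
      (show 0 < α / 8 by positivity)
    filter_upwards [this] with n hn
    simp only [Function.comp_apply, Real.norm_eq_abs, id, Nat.abs_cast] at hn
    exact (le_abs_self _).trans hn
  filter_upwards [hlog, tendsto_natCast_atTop_atTop.eventually_ge_atTop (8 * (B + 1)),
    eventually_gt_atTop 0] with n hn hnB hn0
  have hn' : (0 : ℝ) < n := by exact_mod_cast hn0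
  have hkn := abs_le.1 (hk n)
  have h1 : Real.log n / α ≤ n / 8 := by
    rw [div_le_iff₀ hα]; linarith
  have h2 : (k n : ℝ) + 1 ≤ n / 4 := by linarith
  have h3 : (n : ℝ) ≤ 2 * ((n / 2 : ℕ) : ℝ) + 1 := by exact_mod_cast (by lia)
  have hkL : k n ≤ n / 2 := by
    have : (k n : ℝ) ≤ ((n / 2 : ℕ) : ℝ) := by linarith
    exact_mod_cast this
  have h4 : Real.exp (-(α * B)) * Real.exp (α * k n) ≤ n := by
    rw [← Real.exp_add]
    conv_rhs => rw [← Real.exp_log hn']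
    rw [Real.exp_le_exp]
    have h5 : α * (k n - B) ≤ α * (Real.log n / α) := by gcongr; linarith
    rw [mul_div_cancel₀ _ hα.ne'] at h5
    linarith
  have := hmatch 0 (n / 2 - k n) (k n) n Set.univ (by rw [Nat.cast_sub hkL]; linarith) (by lia)
    MeasurableSet.univ
  rw [probReal_univ, mul_one, Set.inter_univ] at this
  refine this.trans (measureReal_mono fun σ hσ => ?_)
  exact le_matchCount_of_forall_matchWithin (M := 1) (L' := n) (L := n) (s := fun _ => 0)
    (by simp) (fun t ht => by
      obtain rfl : t = 0 := by lia
      simp) fun t _ => hσ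

end Asymptotics

/-! ### Tightness and failure of convergence to zero -/

/-- A sequence of counting variables with uniform `O(1/m)` tails is tight. -/
lemma isTightMeasureSet_range_map_natCast {Ω : Type*} [MeasurableSpace Ω] {μ : Measure Ω}
    [IsFiniteMeasure μ] {N : ℕ → Ω → ℕ} (hN : ∀ n, Measurable (N n)) {D : ℝ}
    (h : ∀ n m : ℕ, 0 < m → μ.real {x | m ≤ N n x} ≤ D / m) :
    IsTightMeasureSet (Set.range fun n : ℕ => μ.map fun x => (N n x : ℝ)) := by
  rw [isTightMeasureSet_iff_exists_isCompact_measure_compl_le]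
  intro ε hε
  by_cases htop : ε = ⊤
  · exact ⟨∅, isCompact_empty, fun _ _ => htop ▸ le_top⟩
  have hε' : 0 < ε.toReal := ENNReal.toReal_pos hε.ne' htop
  obtain ⟨m, hm⟩ := exists_nat_gt (D / ε.toReal)
  refine ⟨Set.Icc 0 ((m + 1 : ℕ) : ℝ), isCompact_Icc, ?_⟩
  rintro _ ⟨n, rfl⟩
  have hmeas : Measurable fun x => (N n x : ℝ) := measurable_from_nat.comp (hN n)
  rw [Measure.map_apply hmeas measurableSet_Icc.compl]
  refine (ENNReal.toReal_le_toReal (measure_ne_top _ _) htop).1 ?_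
  calc μ.real ((fun x => (N n x : ℝ)) ⁻¹' (Set.Icc 0 ((m + 1 : ℕ) : ℝ))ᶜ)
      ≤ μ.real {x | m + 1 ≤ N n x} := by
        refine measureReal_mono fun x hx => ?_
        simp only [Set.mem_preimage, Set.mem_compl_iff, Set.mem_Icc, Nat.cast_nonneg, true_and,
          not_le, Nat.cast_lt] at hx
        exact hx.le
    _ ≤ D / (m + 1 : ℕ) := h n (m + 1) m.succ_pos
    _ ≤ ε.toReal := by
        rw [div_lt_iff₀ hε'] at hm
        rw [div_le_iff₀ (by positivity)]
        push_cast
        nlinarith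

/-- Counting variables that are positive with probability bounded away from zero do not converge
to zero in distribution. -/
lemma not_tendstoInDistribution_natCast_zero {Ω : Type*} [MeasurableSpace Ω] {μ : Measure Ω}
    [IsProbabilityMeasure μ] {N : ℕ → Ω → ℕ} (hN : ∀ n, Measurable (N n)) {δ : ℝ} (hδ : 0 < δ)
    (h : ∀ᶠ n in atTop, δ ≤ μ.real {x | 0 < N n x}) :
    ¬ TendstoInDistribution (fun (n : ℕ) (x : Ω) => (N n x : ℝ)) atTop (fun _ : Ω => (0 : ℝ))
      (fun _ => μ) μ := by
  intro hd
  have hfr : (μ.map fun _ : Ω => (0 : ℝ)) (frontier (Set.Ici (1 / 2 : ℝ))) = 0 := by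
    -- For integer-valued variables being positive means lying in `[1/2, ∞)`, whose frontier has no
    -- mass under the law of zero, so the portmanteau theorem applies.
    rw [frontier_Ici, Measure.map_apply measurable_const (measurableSet_singleton _)]
    simp
  have ht := ProbabilityMeasure.tendsto_measure_of_null_frontier_of_tendsto' hd.tendsto
    (E := Set.Ici (1 / 2 : ℝ)) hfr
  have hlim : (μ.map fun _ : Ω => (0 : ℝ)) (Set.Ici (1 / 2 : ℝ)) = 0 := by
    rw [Measure.map_apply measurable_const measurableSet_Ici]
    simp
  have hterm : ∀ n, (μ.map fun x => (N n x : ℝ)) (Set.Ici (1 / 2 : ℝ)) = μ {x | 0 < N n x} := by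
    intro n
    have hmeas : Measurable fun x => (N n x : ℝ) := measurable_from_nat.comp (hN n)
    rw [Measure.map_apply hmeas measurableSet_Ici]
    congr 1
    ext x
    simp only [Set.mem_preimage, Set.mem_Ici, Set.mem_ofPred_eq]
    constructor
    · intro hx
      by_contra h0
      rw [Nat.eq_zero_of_not_pos h0, Nat.cast_zero] at hx
      linarith
    · intro hx
      have : (1 : ℝ) ≤ N n x := by exact_mod_cast hx
      linarith
  have ht' : Tendsto (fun n => μ {x | 0 < N n x}) atTop (𝓝 0) := by
    have := ht
    simp only [ProbabilityMeasure.coe_mk, hterm, hlim] at this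
    exact this
  have ht'' : Tendsto (fun n => μ.real {x | 0 < N n x}) atTop (𝓝 0) := by
    exact (ENNReal.tendsto_toReal ENNReal.zero_ne_top).comp ht'
  obtain ⟨n, h1, h2⟩ := (h.and (ht''.eventually_lt_const hδ)).exists
  linarith

end ShiftMatch

/-! ### Assembly of the theorem -/

theorem theorem4p1 {𝒜 : Type*} [Fintype 𝒜] [Nontrivial 𝒜] [DecidableEq 𝒜]
    [MeasurableSpace 𝒜] [MeasurableSingletonClass 𝒜]
    (U : Finset ℤ → (ℤ → 𝒜) → ℝ) (hU : ShiftMatch.IsInteraction U)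
    (μ : Measure (ℤ → 𝒜)) [IsProbabilityMeasure μ] (hμ : ShiftMatch.IsGibbsMeasure U μ)
    (k : ℕ → ℕ) :
    (Tendsto (fun n : ℕ => ShiftMatch.kStar U n - (k n : ℝ)) atTop atTop →
      ∀ m : ℕ, 0 < m →
        Tendsto (fun n : ℕ => μ.real {σ | ShiftMatch.matchCount σ n (k n) ≤ m}) atTop (𝓝 0)) ∧
    (Tendsto (fun n : ℕ => (k n : ℝ) - ShiftMatch.kStar U n) atTop atTop →
      ∀ m : ℕ, 0 < m →
        Tendsto (fun n : ℕ => μ.real {σ | m ≤ ShiftMatch.matchCount σ n (k n)}) atTop (𝓝 0)) ∧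
    ((∃ B : ℝ, ∀ n : ℕ, |(k n : ℝ) - ShiftMatch.kStar U n| ≤ B) →
      IsTightMeasureSet
        (Set.range fun n : ℕ => μ.map fun σ => (ShiftMatch.matchCount σ n (k n) : ℝ)) ∧
      ¬ TendstoInDistribution (fun (n : ℕ) (σ : ℤ → 𝒜) => (ShiftMatch.matchCount σ n (k n) : ℝ))
        atTop (fun _ : ℤ → 𝒜 => (0 : ℝ)) (fun _ => μ) μ ∧
      (∃ C : ℝ, 0 < C ∧ ∀ m : ℕ, 0 < m →
        limsup (fun n : ℕ => μ.real {σ | m < ShiftMatch.matchCount σ n (k n)}) atTop ≤ C / m) ∧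
      0 < liminf (fun n : ℕ => μ.real {σ | 0 < ShiftMatch.matchCount σ n (k n)}) atTop) := by
  obtain ⟨c, C, h⟩ := hμ.exists_matchEstimates hU
  refine ⟨fun hk m _ => h.tendsto_measureReal_le_zero hk m,
    fun hk m hm => h.tendsto_measureReal_ge_zero hk hm, ?_⟩
  rintro ⟨B, hB⟩
  obtain ⟨D, hD, htail⟩ := h.exists_measureReal_le_div (k := k) hB
  obtain ⟨δ, hδ, hpos⟩ := h.exists_eventually_le_measureReal (k := k) hB
  have hmeas : ∀ n, Measurable fun σ : ℤ → 𝒜 => ShiftMatch.matchCount σ n (k n) := fun n =>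
    ShiftMatch.measurable_matchCount n (k n)
  refine ⟨ShiftMatch.isTightMeasureSet_range_map_natCast hmeas htail,
    ShiftMatch.not_tendstoInDistribution_natCast_zero hmeas hδ hpos,
    ⟨D, hD, fun m hm => ?_⟩, hδ.trans_le ?_⟩
  · refine limsup_le_of_le ?_ (Eventually.of_forall fun n =>
      (measureReal_mono fun σ hσ => ?_).trans (htail n m hm))
    -- In `ℝ` the limsup can be compared only once the sequence is known to be bounded below; the
    -- liminf likewise needs a bound above.
    · exact (isBoundedUnder_of ⟨0, fun n => measureReal_nonneg⟩ :
        IsBoundedUnder (· ≥ ·) atTop _).isCoboundedUnder_le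
    · exact (show m < _ from hσ).le
  · refine le_liminf_of_le ?_ hpos
    exact (isBoundedUnder_of ⟨1, fun n => measureReal_le_one⟩ :
      IsBoundedUnder (· ≤ ·) atTop _).isCoboundedUnder_ge
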